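/- Let $R$ be a principal ideal domain. For a finitely generated $R$-module $L$ write $\operatorname{rank}_R L=\dim_{\mathrm{Frac}(R)}(\mathrm{Frac}(R)\otimes_R L)$. Let $M$ be a matroid on a finite ground set $E$. An $R$-quasi-representation $\rho$ of $M$ in a finitely generated $R$-module $N$ assigns to each $S\subseteq E$ a submodule $\rho(S)\subseteq N$ such that $\operatorname{rank}_R\rho(S)=\operatorname{rank}_M(S)$, $\rho(\emptyset)=0$, $\rho(E)=N$, $\rho(S_1)\subseteq\rho(S_2)$ whenever $S_1\subseteq S_2\subseteq E$, and $\rho(S_1)=\rho(S_2)$ whenever moreover $\operatorname{rank}_M(S_1)=\operatorname{rank}_M(S_2)$. Fix a total order on $E$. The graded cochain complex $C^{\bullet}(M,\rho)$ has chain groups $$C^{i,j}(M,\rho)=\bigoplus_{S\subseteq E,\ |S|=i}\textstyle\bigwedge^j\bigl(N/\rho(S)\bigr)\qquad(i,j\ge 0),$$ and its differential $d^{i,j}:C^{i,j}\to C^{i+1,j}$ is, on the summand of $S$, the sum over $e\in E\setminus S$ of $\epsilon^{S,e}=(-1)^{|\{e'\in S\,:\,e'<e\}|}$ times the map $\bigwedge^j(N/\rho(S))\to\bigwedge^j(N/\rho(S\cup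 e))$ induced by the projection. Let $H^{i,j}(M,\rho)$ be its cohomology. Let $(M,\rho)$ and $(M',\rho')$ be matroids with $R$-quasi-representations (in $N$ and $N'$) on disjoint finite ground sets $E$ and $E'$. Their direct sum $(M,\rho)\oplus(M',\rho')$ is the matroid $M\oplus M'$ on $E\cup E'$ with the quasi-representation $S\mapsto\rho(S\cap E)\oplus\rho'(S\cap E')\subseteq N\oplus N'$. Fix any total order on $E\cup E'$ and use its restrictions to $E$ and $E'$. The tensor product of two graded complexes $A,B$ is $$(A\otimes B)^{i,j}=\bigoplus_{a+a'=i,\ b+b'=j}A^{a,b}\otimes_R B^{a',b'},\qquad d(x\otimes y)=dx\otimes y+(-1)^{a}x\otimes dy\quad(x\in A^{a,b}).$$ **Proposition.** There is an isomorphism of graded cochain complexes of $R$-modules $$\Phi:\;C^{\bullet}(M,\rho)\otimes C^{\bullet}(M',\rho')\;\xrightarrow{\ \cong\ }\;C^{\bullet}\bigl((M,\rho)\oplus(M',\rho')\bigr).$$ If moreover $R$ is a field, then for all $i,j\ge 0$ the rule $[x]\otimes[y]\mapsto[\Phi(x\otimes y)]$ is a well-defined isomorphism of $R$-vector spaces $$\bigoplus_{l=0}^{i}\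 \bigoplus_{j'=0}^{j}H^{i-l,\,j-j'}(M,\rho)\otimes_R H^{l,j'}(M',\rho')\;\xrightarrow{\ \cong\ }\;H^{i,j}\bigl((M,\rho)\oplus(M',\rho')\bigr).$$ -/

import Mathlib

open scoped TensorProduct DirectSum

noncomputable section

set_option linter.unusedSectionVars false

namespace MatroidCohomology

universe u v w

/-! ## Graded cochain complexes -/

/-- A graded cochain complex of `R`-modules, concentrated in cohomological degrees `i ≥ 0` and
internal degrees `j ≥ 0`.  The chain group in cohomological degree `i` is the graded module
`⨁ j, X i j`, and the differential raises `i` by one and preserves `j`. -/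
structure GradedComplex (R : Type u) [CommRing R] where
  X : ℕ → ℕ → Type v
  [addCommGroup : ∀ i j, AddCommGroup (X i j)]
  [module : ∀ i j, Module R (X i j)]
  d : ∀ i j, X i j →ₗ[R] X (i + 1) j
  d_comp_d : ∀ i j, d (i + 1) j ∘ₗ d i j = 0

attribute [instance] GradedComplex.addCommGroup GradedComplex.module

namespace GradedComplex

variable {R : Type u} [CommRing R]

/-- The cocycles in bidegree `(i, j)`. -/
def cocycles (A : GradedComplex.{u, v} R) (i j : ℕ) : Submodule R (A.X i j) :=
  LinearMap.ker (A.d i j)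

/-- The coboundaries in bidegree `(i, j)`. -/
def coboundaries (A : GradedComplex.{u, v} R) : ∀ i j : ℕ, Submodule R (A.X i j)
  | 0, _ => ⊥
  | i + 1, j => LinearMap.range (A.d i j)

/-- The cohomology `H^{i,j}`: cocycles modulo coboundaries. -/
abbrev cohomology (A : GradedComplex.{u, v} R) (i j : ℕ) : Type v :=
  A.cocycles i j ⧸ (A.coboundaries i j).submoduleOf (A.cocycles i j)

/-- The cohomology class of a cocycle. -/
def cohomologyClass (A : GradedComplex.{u, v} R) {i j : ℕ} (x : A.cocycles i j) :
    A.cohomology i j :=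
  Submodule.Quotient.mk x

/-- An isomorphism of graded cochain complexes. -/
structure Iso (A : GradedComplex.{u, v} R) (B : GradedComplex.{u, w} R) where
  equiv : ∀ i j, A.X i j ≃ₗ[R] B.X i j
  comm : ∀ i j (x : A.X i j), equiv (i + 1) j (A.d i j x) = B.d i j (equiv i j x)

/-- Pairs of pairs of natural numbers, the first with sum `i` and the second with sum `j`. -/
abbrev Split (i j : ℕ) : Type :=
  {p : ℕ × ℕ // p.1 + p.2 = i} × {q : ℕ × ℕ // q.1 + q.2 = j}

/-- The bidegree `(i, j)` part of the tensor product of two graded complexes: the direct sum of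
the `A^{i', j'} ⊗ B^{i'', j''}` with `i' + i'' = i` and `j' + j'' = j`. -/
abbrev TensorX (A : GradedComplex.{u, v} R) (B : GradedComplex.{u, w} R) (i j : ℕ) :
    Type (max v w) :=
  ⨁ s : Split i j, A.X s.1.1.1 s.2.1.1 ⊗[R] B.X s.1.1.2 s.2.1.2

/-- The inclusion of the summand `A^{a, b} ⊗ B^{a', b'}` of the tensor product. -/
def tensorIncl (A : GradedComplex.{u, v} R) (B : GradedComplex.{u, w} R) {i j a a' b b' : ℕ}
    (hi : a + a' = i) (hj : b + b' = j) :
    A.X a b ⊗[R] B.X a' b' →ₗ[R] TensorX A B i j :=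
  DirectSum.lof R (Split i j)
    (fun s : Split i j => A.X s.1.1.1 s.2.1.1 ⊗[R] B.X s.1.1.2 s.2.1.2)
    (⟨(a, a'), hi⟩, ⟨(b, b'), hj⟩)

/-- The differential `d (x ⊗ y) = d x ⊗ y + (-1)^{a} x ⊗ d y`, where `a` is the cohomological
degree of `x`. -/
def tensorD (A : GradedComplex.{u, v} R) (B : GradedComplex.{u, w} R) (i j : ℕ) :
    TensorX A B i j →ₗ[R] TensorX A B (i + 1) j :=
  DirectSum.toModule R (Split i j) (TensorX A B (i + 1) j) fun s =>
    tensorIncl A B (by have := s.1.2; omega) s.2.2 ∘ₗ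
        (A.d s.1.1.1 s.2.1.1).rTensor (B.X s.1.1.2 s.2.1.2) +
      ((-1 : R) ^ s.1.1.1) •
        (tensorIncl A B (by have := s.1.2; omega) s.2.2 ∘ₗ
          (B.d s.1.1.2 s.2.1.2).lTensor (A.X s.1.1.1 s.2.1.1))

theorem tensorD_tensorIncl (A : GradedComplex.{u, v} R) (B : GradedComplex.{u, w} R)
    {i j a a' b b' : ℕ} (hi : a + a' = i) (hj : b + b' = j) (x : A.X a b) (y : B.X a' b') :
    tensorD A B i j (tensorIncl A B hi hj (x ⊗ₜ y)) =
      tensorIncl A B (by omega) hj (A.d a b x ⊗ₜ y) +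
        ((-1 : R) ^ a) • tensorIncl A B (by omega) hj (x ⊗ₜ B.d a' b' y) := by
  rw [tensorD, tensorIncl, DirectSum.toModule_lof]
  rfl

theorem tensorD_comp_tensorD (A : GradedComplex.{u, v} R) (B : GradedComplex.{u, w} R)
    (i j : ℕ) : tensorD A B (i + 1) j ∘ₗ tensorD A B i j = 0 := by
  have hA : ∀ i j x, A.d (i + 1) j (A.d i j x) = 0 := fun i j x =>
    LinearMap.congr_fun (A.d_comp_d i j) x
  have hB : ∀ i j x, B.d (i + 1) j (B.d i j x) = 0 := fun i j x =>
    LinearMap.congr_fun (B.d_comp_d i j) x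
  refine DirectSum.linearMap_ext R fun s => TensorProduct.ext' fun x y => ?_
  change tensorD A B (i + 1) j (tensorD A B i j (tensorIncl A B s.1.2 s.2.2 (x ⊗ₜ y))) = 0
  simp only [tensorD_tensorIncl, map_add, map_smul, hA, hB, TensorProduct.zero_tmul,
    TensorProduct.tmul_zero, map_zero, smul_zero, zero_add, add_zero, pow_succ, mul_neg_one]
  rw [← add_smul, neg_add_cancel, zero_smul]

/-- The tensor product of two graded complexes. -/
abbrev tensor (A : GradedComplex.{u, v} R) (B : GradedComplex.{u, w} R) :
    GradedComplex.{u, max v w} R where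
  X := TensorX A B
  d := tensorD A B
  d_comp_d := tensorD_comp_tensorD A B

end GradedComplex

/-! ## Quasi-representations of matroids -/

/-- The rank of a module over a domain: the dimension of its base change to the fraction field. -/
def moduleRank (R : Type u) [CommRing R] [IsDomain R] (L : Type v) [AddCommGroup L]
    [Module R L] : ℕ :=
  Module.finrank (FractionRing R) (FractionRing R ⊗[R] L)

/-- An `R`-quasi-representation of `M` in the module `N`; only the values `ρ S` on subsets `S` of
the ground set of `M` are meaningful. -/
structure QuasiRep (R : Type u) [CommRing R] [IsDomain R] {α : Type v} (M : Matroid α)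
    (N : Type w) [AddCommGroup N] [Module R N] where
  ρ : Set α → Submodule R N
  rank_eq : ∀ S, S ⊆ M.E → (moduleRank R (ρ S) : ℕ∞) = M.eRk S
  empty_eq : ρ ∅ = ⊥
  ground_eq : ρ M.E = ⊤
  mono : ∀ S T, S ⊆ T → T ⊆ M.E → ρ S ≤ ρ T
  eq_of_rank_eq : ∀ S T, S ⊆ T → T ⊆ M.E → M.eRk S = M.eRk T → ρ S = ρ T

section DirectSum

instance finite_disjointSum {α : Type v} (M M' : Matroid α) (h : Disjoint M.E M'.E) [M.Finite]
    [M'.Finite] : (M.disjointSum M' h).Finite :=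
  ⟨by
    rw [Matroid.disjointSum_ground_eq]
    exact M.ground_finite.union M'.ground_finite⟩

theorem eRk_disjointSum {α : Type v} (M M' : Matroid α) (h : Disjoint M.E M'.E) (S : Set α)
    (hS : S ⊆ M.E ∪ M'.E) :
    (M.disjointSum M' h).eRk S = M.eRk (S ∩ M.E) + M'.eRk (S ∩ M'.E) := by
  obtain ⟨I, hI⟩ := (M.disjointSum M' h).exists_isBasis S (by simpa using hS)
  rw [hI.eRk_eq_encard]
  have hI' := hI
  rw [Matroid.disjointSum_isBasis_iff] at hI'
  obtain ⟨h1, h2, hIS, -⟩ := hI'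
  rw [h1.eRk_eq_encard, h2.eRk_eq_encard, ← Set.encard_union_eq, ← Set.inter_union_distrib_left,
    Set.inter_eq_self_of_subset_left (hIS.trans hS)]
  exact h.mono Set.inter_subset_right Set.inter_subset_right

theorem moduleRank_prod (R : Type u) [CommRing R] [IsDomain R] {N : Type v} {N' : Type w}
    [AddCommGroup N] [Module R N] [AddCommGroup N'] [Module R N'] [IsNoetherian R N]
    [IsNoetherian R N'] (p : Submodule R N) (p' : Submodule R N') :
    moduleRank R (p.prod p') = moduleRank R p + moduleRank R p' := by
  unfold moduleRank
  let e0 : p.prod p' ≃ₗ[R] p × p' :=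
    { toFun := fun x => (⟨x.1.1, x.2.1⟩, ⟨x.1.2, x.2.2⟩)
      invFun := fun x => ⟨(x.1, x.2), x.1.2, x.2.2⟩
      map_add' := fun _ _ => rfl
      map_smul' := fun _ _ => rfl }
  have e : FractionRing R ⊗[R] (p.prod p') ≃ₗ[FractionRing R]
      (FractionRing R ⊗[R] p) × (FractionRing R ⊗[R] p') :=
    (TensorProduct.AlgebraTensorModule.congr (LinearEquiv.refl _ _) e0).trans
      (TensorProduct.prodRight R (FractionRing R) (FractionRing R) p p')
  rw [e.finrank_eq, Module.finrank_prod]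

variable {R : Type u} [CommRing R] [IsDomain R] [IsPrincipalIdealRing R] {α : Type*}
  {M M' : Matroid α} [M.Finite] [M'.Finite] {N : Type v} {N' : Type w}
  [AddCommGroup N] [Module R N] [Module.Finite R N]
  [AddCommGroup N'] [Module R N'] [Module.Finite R N']

/-- The direct sum quasi-representation `S ↦ ρ (S ∩ E) ⊕ ρ' (S ∩ E')` in `N ⊕ N'` of the direct
sum of two matroids on disjoint ground sets `E` and `E'`. -/
def QuasiRep.directSum (ρ : QuasiRep R M N) (ρ' : QuasiRep R M' N') (h : Disjoint M.E M'.E) :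
    QuasiRep R (M.disjointSum M' h) (N × N') where
  ρ S := (ρ.ρ (S ∩ M.E)).prod (ρ'.ρ (S ∩ M'.E))
  rank_eq S hS := by
    rw [Matroid.disjointSum_ground_eq] at hS
    rw [moduleRank_prod, eRk_disjointSum M M' h S hS, Nat.cast_add,
      ρ.rank_eq _ Set.inter_subset_right, ρ'.rank_eq _ Set.inter_subset_right]
  empty_eq := by simp [ρ.empty_eq, ρ'.empty_eq]
  ground_eq := by
    have h1 : (M.E ∪ M'.E) ∩ M.E = M.E := Set.union_inter_cancel_left
    have h2 : (M.E ∪ M'.E) ∩ M'.E = M'.E := Set.union_inter_cancel_right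
    rw [Matroid.disjointSum_ground_eq, h1, h2, ρ.ground_eq, ρ'.ground_eq, Submodule.prod_top]
  mono S T hST _ := Submodule.prod_mono
    (ρ.mono _ _ (Set.inter_subset_inter_left _ hST) Set.inter_subset_right)
    (ρ'.mono _ _ (Set.inter_subset_inter_left _ hST) Set.inter_subset_right)
  eq_of_rank_eq S T hST hT hr := by
    rw [Matroid.disjointSum_ground_eq] at hT
    rw [eRk_disjointSum M M' h S (hST.trans hT), eRk_disjointSum M M' h T hT] at hr
    have i1 : S ∩ M.E ⊆ T ∩ M.E := Set.inter_subset_inter_left _ hST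
    have i2 : S ∩ M'.E ⊆ T ∩ M'.E := Set.inter_subset_inter_left _ hST
    have l1 := M.eRk_mono i1
    have l2 := M'.eRk_mono i2
    rw [← ρ.rank_eq _ Set.inter_subset_right, ← ρ.rank_eq _ Set.inter_subset_right] at l1
    rw [← ρ'.rank_eq _ Set.inter_subset_right, ← ρ'.rank_eq _ Set.inter_subset_right] at l2
    rw [← ρ.rank_eq _ Set.inter_subset_right, ← ρ.rank_eq _ Set.inter_subset_right,
      ← ρ'.rank_eq _ Set.inter_subset_right, ← ρ'.rank_eq _ Set.inter_subset_right] at hr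
    norm_cast at l1 l2 hr
    congr 1
    · refine ρ.eq_of_rank_eq _ _ i1 Set.inter_subset_right ?_
      rw [← ρ.rank_eq _ Set.inter_subset_right, ← ρ.rank_eq _ Set.inter_subset_right]
      norm_cast
      omega
    · refine ρ'.eq_of_rank_eq _ _ i2 Set.inter_subset_right ?_
      rw [← ρ'.rank_eq _ Set.inter_subset_right, ← ρ'.rank_eq _ Set.inter_subset_right]
      norm_cast
      omega

end DirectSum

/-! ## The characteristic cohomology -/

/-- The sign `ε^{S,e} = (-1)^{#{e' ∈ S | e' < e}}`. -/
def sign (R : Type u) [CommRing R] {α : Type*} [LinearOrder α] (S : Finset α) (e : α) : R :=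
  (-1) ^ (S.filter fun e' => e' < e).card

theorem sign_mul_sign (R : Type u) [CommRing R] {α : Type*} [LinearOrder α] (S : Finset α)
    {e f : α} (he : e ∉ S) (hf : f ∉ S) (hef : e ≠ f) :
    sign R S e * sign R (insert e S) f + sign R S f * sign R (insert f S) e = 0 := by
  have key : ∀ a b : α, a ∉ S → a < b →
      sign R S a * sign R (insert a S) b + sign R S b * sign R (insert b S) a = 0 := by
    intro a b ha hab
    have h1 : (insert a S).filter (fun e' => e' < b) = insert a (S.filter fun e' => e' < b) := by
      rw [Finset.filter_insert, if_pos hab]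
    have h2 : (insert b S).filter (fun e' => e' < a) = S.filter fun e' => e' < a := by
      rw [Finset.filter_insert, if_neg hab.le.not_gt]
    rw [sign, sign, sign, sign, h1, h2, Finset.card_insert_of_notMem (by simp [ha]), pow_succ]
    ring
  rcases lt_or_gt_of_ne hef with h | h
  · exact key e f he h
  · rw [add_comm]
    exact key f e hf h

section Complex

variable {R : Type u} [CommRing R] [IsDomain R] {α : Type*} [LinearOrder α]
  {M : Matroid α} [M.Finite] {N : Type w} [AddCommGroup N] [Module R N]

/-- The subsets of cardinality `i` of the ground set of `M`. -/
abbrev Subs (M : Matroid α) (i : ℕ) : Type _ := {S : Finset α // (S : Set α) ⊆ M.E ∧ S.card = i}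

/-- The elements of the ground set of `M` that are not in `S`. -/
def outside (M : Matroid α) [M.Finite] (S : Finset α) : Finset α := M.ground_finite.toFinset \ S

theorem mem_outside {S : Finset α} {e : α} : e ∈ outside M S ↔ e ∈ M.E ∧ e ∉ S := by
  simp [outside]

/-- The set `S ∪ {e}` for `e ∉ S`. -/
def Subs.insert {i : ℕ} (S : Subs M i) (e : outside M S.1) : Subs M (i + 1) :=
  ⟨Insert.insert e.1 S.1, by
    rw [Finset.coe_insert]
    exact Set.insert_subset (mem_outside.1 e.2).1 S.2.1, by
    rw [Finset.card_insert_of_notMem (mem_outside.1 e.2).2, S.2.2]⟩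

/-- The chain group `C^{S,j} = ⋀^j (N / ρ(S))`. -/
abbrev chainAt (ρ : QuasiRep R M N) (S : Finset α) (j : ℕ) : Type _ := ⋀[R]^j (N ⧸ ρ.ρ (S : Set α))

/-- The map `d^{S,e} : ⋀^j (N / ρ(S)) → ⋀^j (N / ρ(S ∪ e))` induced by the projection. -/
def dAt (ρ : QuasiRep R M N) {i : ℕ} (S : Subs M i) (e : outside M S.1) (j : ℕ) :
    chainAt ρ S.1 j →ₗ[R] chainAt ρ (S.insert e).1 j :=
  exteriorPower.map j (Submodule.factor (ρ.mono _ _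
    (Finset.coe_subset.2 (Finset.subset_insert e.1 S.1)) (S.insert e).2.1))

/-- The chain group `C^{i,j}`, the direct sum of the `C^{S,j}` over the subsets `S` of the ground
set with `i` elements. -/
abbrev chainGroup (ρ : QuasiRep R M N) (i j : ℕ) : Type _ := ⨁ S : Subs M i, chainAt ρ S.1 j

/-- The inclusion of the summand `C^{S,j}`. -/
abbrev chainIncl (ρ : QuasiRep R M N) {i : ℕ} (S : Subs M i) (j : ℕ) :
    chainAt ρ S.1 j →ₗ[R] chainGroup ρ i j :=
  DirectSum.lof R (Subs M i) (fun S : Subs M i => chainAt ρ S.1 j) S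

/-- The differential: on the summand `C^{S,j}` it is the sum over `e ∉ S` of the maps
`ε^{S,e} d^{S,e}`. -/
def chainD (ρ : QuasiRep R M N) (i j : ℕ) : chainGroup ρ i j →ₗ[R] chainGroup ρ (i + 1) j :=
  DirectSum.toModule R (Subs M i) (chainGroup ρ (i + 1) j) fun S =>
    ∑ e : outside M S.1, sign R S.1 e.1 • (chainIncl ρ (S.insert e) j ∘ₗ dAt ρ S e j)

theorem chainIncl_factor_congr (ρ : QuasiRep R M N) {i : ℕ} (S : Finset α) (j : ℕ)
    {T T' : Subs M i} (hT : T = T') (h : ρ.ρ S ≤ ρ.ρ T.1) (h' : ρ.ρ S ≤ ρ.ρ T'.1)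
    (x : chainAt ρ S j) :
    chainIncl ρ T j (exteriorPower.map j (Submodule.factor h) x) =
      chainIncl ρ T' j (exteriorPower.map j (Submodule.factor h') x) := by
  subst hT
  rfl

theorem dAt_dAt (ρ : QuasiRep R M N) {i : ℕ} (S : Subs M i) (e : outside M S.1)
    (f : outside M (S.insert e).1) (j : ℕ) (x : chainAt ρ S.1 j)
    (h : ρ.ρ (S.1 : Set α) ≤ ρ.ρ ((S.insert e).insert f).1) :
    dAt ρ (S.insert e) f j (dAt ρ S e j x) = exteriorPower.map j (Submodule.factor h) x := by
  rw [dAt, dAt, ← LinearMap.comp_apply, ← exteriorPower.map_comp, Submodule.factor_comp]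

theorem chainD_chainIncl (ρ : QuasiRep R M N) {i : ℕ} (S : Subs M i) (j : ℕ)
    (x : chainAt ρ S.1 j) :
    chainD ρ i j (chainIncl ρ S j x) =
      ∑ e : outside M S.1, sign R S.1 e.1 • chainIncl ρ (S.insert e) j (dAt ρ S e j x) := by
  rw [chainD, DirectSum.toModule_lof, LinearMap.sum_apply]
  rfl

theorem chainD_comp_chainD (ρ : QuasiRep R M N) (i j : ℕ) :
    chainD ρ (i + 1) j ∘ₗ chainD ρ i j = 0 := by
  refine DirectSum.linearMap_ext R fun S => LinearMap.ext fun x => ?_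
  change chainD ρ (i + 1) j (chainD ρ i j (chainIncl ρ S j x)) = 0
  have hle : ∀ (e : outside M S.1) (f : outside M (S.insert e).1),
      ρ.ρ (S.1 : Set α) ≤ ρ.ρ ((S.insert e).insert f).1 := fun e f =>
    ρ.mono _ _ (Finset.coe_subset.2 ((Finset.subset_insert _ _).trans (Finset.subset_insert _ _)))
      ((S.insert e).insert f).2.1
  have hmem : ∀ (e : outside M S.1) (f : outside M (S.insert e).1),
      f.1 ∈ outside M S.1 ∧ e.1 ≠ f.1 := fun e f => by
    have hf := mem_outside.1 f.2
    have hf2 : f.1 ∉ insert e.1 S.1 := hf.2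
    rw [Finset.mem_insert, not_or] at hf2
    exact ⟨mem_outside.2 ⟨hf.1, hf2.2⟩, fun h => hf2.1 h.symm⟩
  have hmem' : ∀ (e : outside M S.1) (f : outside M (S.insert e).1),
      e.1 ∈ outside M (S.insert ⟨f.1, (hmem e f).1⟩).1 := fun e f => by
    refine mem_outside.2 ⟨(mem_outside.1 e.2).1, ?_⟩
    change e.1 ∉ insert f.1 S.1
    rw [Finset.mem_insert, not_or]
    exact ⟨(hmem e f).2, (mem_outside.1 e.2).2⟩
  simp only [chainD_chainIncl, map_sum, map_smul, Finset.smul_sum, smul_smul]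
  rw [Finset.sum_sigma']
  refine Finset.sum_involution
    (fun p _ => ⟨⟨p.2.1, (hmem p.1 p.2).1⟩, ⟨p.1.1, hmem' p.1 p.2⟩⟩) ?_ ?_ ?_ ?_
  · rintro ⟨e, f⟩ -
    have hT : (S.insert ⟨f.1, (hmem e f).1⟩).insert ⟨e.1, hmem' e f⟩ = (S.insert e).insert f :=
      Subtype.ext (Finset.insert_comm e.1 f.1 S.1)
    rw [dAt_dAt ρ S e f j x (hle e f), dAt_dAt ρ S _ ⟨e.1, hmem' e f⟩ j x (hle _ _),
      chainIncl_factor_congr ρ S.1 j hT (hle _ _) (hle e f), ← add_smul]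
    have := sign_mul_sign R S.1 (mem_outside.1 e.2).2 (mem_outside.1 (hmem e f).1).2 (hmem e f).2
    exact (congrArg (· • _) this).trans (zero_smul R _)
  · rintro ⟨e, f⟩ - - h
    have := congrArg (fun p => p.1.1) h
    exact (hmem e f).2 this.symm
  · intro p _
    simp
  · rintro ⟨e, f⟩ -
    rfl

/-- The complex `C(M, ρ)`, whose cohomology is the characteristic cohomology of `(M, ρ)`. -/
abbrev charComplex (ρ : QuasiRep R M N) : GradedComplex R where
  X := chainGroup ρ
  d := chainD ρ
  d_comp_d := chainD_comp_chainD ρ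

end Complex

end MatroidCohomology

end

noncomputable section

set_option linter.unusedSectionVars false

namespace MatroidCohomology

universe u v w

/-! ## The exterior powers of a direct sum -/

section Wedge

variable {R : Type*} [CommRing R] {A B C D : Type*} [AddCommGroup A] [Module R A]
  [AddCommGroup B] [Module R B] [AddCommGroup C] [Module R C] [AddCommGroup D] [Module R D]

/-! The complexes agree summand by summand. A subset `T` of `E ∪ E'` is uniquely `S ∪ S'` with `S ⊆
E` and `S' ⊆ E'`, and `(N ⊕ N') / (ρ(S) ⊕ ρ'(S'))` is `N / ρ(S) ⊕ N' / ρ'(S')`. The `j`-th exterior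
power of a direct sum is the sum of the `⋀^b ⊗ ⋀^b'` with `b + b' = j` (`wedgeSum_bijective`), so
the wedge product identifies the chain groups.

The wedge product is natural, so it commutes with the projections in the differentials, and only
signs remain. The differential of the direct sum counts the elements of `S ∪ S'` below `e`, while
the tensor differential counts those of `S` or of `S'` alone, with an extra `(-1)^|S|` in the second
case. Multiplying the summand of `(S, S')` by `(-1)` to the number of pairs `s' < s` (`shuffleSign`)
corrects both cases (`sign_mul_shuffleSign_insert_left`, `sign_mul_shuffleSign_insert_right`).

Over a field every complex deformation retracts onto its cohomology (`nonempty_retraction`). The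
tensor product of two such retractions retracts `A ⊗ B` onto `H(A) ⊗ H(B)`, which has zero
differential; this is the Künneth formula. The retractions are choices, but a projection sends a
cocycle to its class, so the isomorphism is given on classes by `[x] ⊗ [y] ↦ [x ⊗ y]`. Composing
with the map induced by `Φ` gives the second claim. -/

theorem coe_exteriorPower_map (n : ℕ) (f : A →ₗ[R] B) (x : ⋀[R]^n A) :
    (exteriorPower.map n f x : ExteriorAlgebra R B) = ExteriorAlgebra.map f x := by
  have : (⋀[R]^n B).subtype ∘ₗ exteriorPower.map n f =
      (ExteriorAlgebra.map f).toLinearMap ∘ₗ (⋀[R]^n A).subtype := by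
    refine exteriorPower.linearMap_ext ?_
    ext v
    simp
  exact LinearMap.congr_fun this x

/-- The product `x ⊗ y ↦ f x ∧ g y` of exterior powers along linear maps `f` and `g` with the same
target. -/
def wedge (f : A →ₗ[R] C) (g : B →ₗ[R] C) {a b j : ℕ} (h : a + b = j) :
    ⋀[R]^a A ⊗[R] ⋀[R]^b B →ₗ[R] ⋀[R]^j C :=
  TensorProduct.lift <| LinearMap.mk₂ R
    (fun x y => ⟨(exteriorPower.map a f x : ExteriorAlgebra R C) *
      (exteriorPower.map b g y : ExteriorAlgebra R C), by
        subst h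
        exact SetLike.mul_mem_graded (A := fun i : ℕ => ⋀[R]^i C) (Subtype.prop _)
          (Subtype.prop _)⟩)
    (fun x x' y => Subtype.ext (by simp [add_mul]))
    (fun c x y => Subtype.ext (by simp))
    (fun x y y' => Subtype.ext (by simp [mul_add]))
    (fun c x y => Subtype.ext (by simp))

theorem coe_wedge_tmul (f : A →ₗ[R] C) (g : B →ₗ[R] C) {a b j : ℕ} (h : a + b = j)
    (x : ⋀[R]^a A) (y : ⋀[R]^b B) :
    (wedge f g h (x ⊗ₜ y) : ExteriorAlgebra R C) =
      ExteriorAlgebra.map f (x : ExteriorAlgebra R A) *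
        ExteriorAlgebra.map g (y : ExteriorAlgebra R B) := by
  rw [← coe_exteriorPower_map, ← coe_exteriorPower_map]
  rfl

theorem map_wedge (k : C →ₗ[R] D) (f : A →ₗ[R] C) (g : B →ₗ[R] C) {a b j : ℕ} (h : a + b = j)
    (t : ⋀[R]^a A ⊗[R] ⋀[R]^b B) :
    exteriorPower.map j k (wedge f g h t) = wedge (k ∘ₗ f) (k ∘ₗ g) h t := by
  induction t with
  | zero => simp
  | add s t hs ht => simp only [map_add, hs, ht]
  | tmul x y =>
    refine Subtype.ext ?_
    rw [coe_exteriorPower_map, coe_wedge_tmul, coe_wedge_tmul, map_mul, ← AlgHom.comp_apply,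
      ← AlgHom.comp_apply, ExteriorAlgebra.map_comp_map, ExteriorAlgebra.map_comp_map]

theorem wedge_map_left (k : D →ₗ[R] A) (f : A →ₗ[R] C) (g : B →ₗ[R] C) {a b j : ℕ}
    (h : a + b = j) (x : ⋀[R]^a D) (y : ⋀[R]^b B) :
    wedge f g h (exteriorPower.map a k x ⊗ₜ y) = wedge (f ∘ₗ k) g h (x ⊗ₜ y) := by
  refine Subtype.ext ?_
  rw [coe_wedge_tmul, coe_wedge_tmul, coe_exteriorPower_map, ← AlgHom.comp_apply,
    ExteriorAlgebra.map_comp_map]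

theorem wedge_map_right (k : D →ₗ[R] B) (f : A →ₗ[R] C) (g : B →ₗ[R] C) {a b j : ℕ}
    (h : a + b = j) (x : ⋀[R]^a A) (y : ⋀[R]^b D) :
    wedge f g h (x ⊗ₜ exteriorPower.map b k y) = wedge f (g ∘ₗ k) h (x ⊗ₜ y) := by
  refine Subtype.ext ?_
  rw [coe_wedge_tmul, coe_wedge_tmul, coe_exteriorPower_map, ← AlgHom.comp_apply,
    ExteriorAlgebra.map_comp_map]

/-- Pairs of natural numbers with sum `j`. -/
abbrev SumPair (j : ℕ) : Type := {q : ℕ × ℕ // q.1 + q.2 = j}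

variable (R A B) in
/-- The bidegree summands of `⋀ A ⊗ ⋀ B`. -/
abbrev BiPower (q : ℕ × ℕ) : Type _ := ⋀[R]^q.1 A ⊗[R] ⋀[R]^q.2 B

/-- The sum of the products `⋀^a A ⊗ ⋀^b B → ⋀^j C` over `a + b = j`. -/
def wedgeSum (f : A →ₗ[R] C) (g : B →ₗ[R] C) (j : ℕ) :
    (⨁ q : SumPair j, BiPower R A B q.1) →ₗ[R] ⋀[R]^j C :=
  DirectSum.toModule R (SumPair j) (⋀[R]^j C) fun q => wedge f g q.2

theorem wedgeSum_lof (f : A →ₗ[R] C) (g : B →ₗ[R] C) (j : ℕ) (q : SumPair j)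
    (t : BiPower R A B q.1) :
    wedgeSum f g j (DirectSum.lof R (SumPair j) (fun q => BiPower R A B q.1) q t) =
      wedge f g q.2 t := by
  rw [wedgeSum, DirectSum.toModule_lof]

variable (R A B) in
-- The exterior algebra is the Clifford algebra of the zero form, and the Clifford algebra of an
-- orthogonal sum is the graded tensor product of the Clifford algebras. The grading twists only the
-- multiplication, so the underlying module is the ordinary tensor product.
theorem exists_exteriorAlgebra_prodEquiv :
    ∃ m : ExteriorAlgebra R A ⊗[R] ExteriorAlgebra R B ≃ₗ[R] ExteriorAlgebra R (A × B),
      ∀ x y, m (x ⊗ₜ y) = ExteriorAlgebra.map (LinearMap.inl R A B) x *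
        ExteriorAlgebra.map (LinearMap.inr R A B) y := by
  let Q₁ : QuadraticForm R A := 0
  let Q₂ : QuadraticForm R B := 0
  have hQ : Q₁.prod Q₂ = 0 := by ext; simp [Q₁, Q₂]
  let i : (Q₁.prod Q₂).IsometryEquiv (0 : QuadraticForm R (A × B)) :=
    { LinearEquiv.refl R (A × B) with map_app' := fun m => by rw [hQ]; rfl }
  let e := (CliffordAlgebra.prodEquiv Q₁ Q₂).symm.trans (CliffordAlgebra.equivOfIsometry i)
  refine ⟨(GradedTensorProduct.of R (CliffordAlgebra.evenOdd Q₁)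
    (CliffordAlgebra.evenOdd Q₂)).trans e.toLinearEquiv, fun x y => ?_⟩
  change CliffordAlgebra.map i.toIsometry
    (CliffordAlgebra.toProd Q₁ Q₂ (GradedTensorProduct.tmul R x y)) = _
  rw [CliffordAlgebra.toProd, GradedTensorProduct.lift_tmul, map_mul, ← AlgHom.comp_apply,
    ← AlgHom.comp_apply, CliffordAlgebra.map_comp_map, CliffordAlgebra.map_comp_map]
  rfl

variable (R A B) in
theorem exists_biPower_equiv :
    ∃ G : (⨁ q : ℕ × ℕ, BiPower R A B q) ≃ₗ[R] ExteriorAlgebra R (A × B),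
      ∀ q t, G (DirectSum.lof R (ℕ × ℕ) (BiPower R A B) q t) =
        wedge (LinearMap.inl R A B) (LinearMap.inr R A B) (rfl : q.1 + q.2 = q.1 + q.2) t := by
  obtain ⟨m, hm⟩ := exists_exteriorAlgebra_prodEquiv R A B
  refine ⟨(TensorProduct.directSum R R (fun i : ℕ => ⋀[R]^i A) (fun i : ℕ => ⋀[R]^i B)).symm.trans
    ((TensorProduct.congr (DirectSum.decomposeLinearEquiv fun i : ℕ => ⋀[R]^i A).symm
      (DirectSum.decomposeLinearEquiv fun i : ℕ => ⋀[R]^i B).symm).trans m), fun q t => ?_⟩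
  induction t using TensorProduct.induction_on with
  | zero => simp
  | add s t hs ht => simp only [map_add, hs, ht, Submodule.coe_add]
  | tmul x y =>
    rw [coe_wedge_tmul, LinearEquiv.trans_apply, LinearEquiv.trans_apply]
    have := TensorProduct.directSum_symm_lof_tmul R R (M₁ := fun i : ℕ => ⋀[R]^i A)
      (M₂ := fun i : ℕ => ⋀[R]^i B) q.1 x q.2 y
    refine (congrArg (fun z => m (TensorProduct.congr _ _ z)) this).trans ?_
    rw [TensorProduct.congr_tmul, hm, DirectSum.decomposeLinearEquiv_symm_lof,
      DirectSum.decomposeLinearEquiv_symm_lof]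

/-- This is the degree `j` part of `G`. Injectivity: followed by the inclusion into the exterior
algebra, the map is `G ∘ incl`, and `incl` has the left inverse `retr`. Surjectivity: `z` is its own
degree `j` component, so dropping the summands of `G⁻¹ z` of other total degree leaves a preimage.
-/
theorem wedgeSum_inl_inr_bijective (j : ℕ) :
    Function.Bijective (wedgeSum (LinearMap.inl R A B) (LinearMap.inr R A B) j) := by
  obtain ⟨G, hG⟩ := exists_biPower_equiv R A B
  let incl : (⨁ q : SumPair j, BiPower R A B q.1) →ₗ[R] ⨁ q : ℕ × ℕ, BiPower R A B q :=
    DirectSum.toModule R _ _ fun q => DirectSum.lof R (ℕ × ℕ) (BiPower R A B) q.1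
  let retr : (⨁ q : ℕ × ℕ, BiPower R A B q) →ₗ[R] ⨁ q : SumPair j, BiPower R A B q.1 :=
    DirectSum.toModule R _ _ fun q => if hq : q.1 + q.2 = j then
      DirectSum.lof R (SumPair j) (fun q => BiPower R A B q.1) ⟨q, hq⟩ else 0
  let proj : ExteriorAlgebra R (A × B) →ₗ[R] ⋀[R]^j (A × B) :=
    DirectSum.component R ℕ (fun i : ℕ => ⋀[R]^i (A × B)) j ∘ₗ
      (DirectSum.decomposeLinearEquiv fun i : ℕ => ⋀[R]^i (A × B)).toLinearMap
  have hproj : ∀ z : ⋀[R]^j (A × B), proj z = z := fun z => by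
    change DirectSum.decompose (fun i : ℕ => ⋀[R]^i (A × B)) (z : ExteriorAlgebra R (A × B)) j = z
    rw [DirectSum.decompose_coe, DirectSum.of_eq_same]
  have hproj' : ∀ (k : ℕ) (z : ⋀[R]^k (A × B)), k ≠ j → proj z = 0 := fun k z hk => by
    change DirectSum.decompose (fun i : ℕ => ⋀[R]^i (A × B)) (z : ExteriorAlgebra R (A × B)) j = 0
    rw [DirectSum.decompose_coe, DirectSum.of_eq_of_ne _ _ _ hk.symm]
  have h1 : retr ∘ₗ incl = LinearMap.id := by
    refine DirectSum.linearMap_ext R fun q => LinearMap.ext fun t => ?_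
    simp only [LinearMap.comp_apply, incl, retr, DirectSum.toModule_lof, dif_pos q.2]
    rfl
  have h2 : wedgeSum (LinearMap.inl R A B) (LinearMap.inr R A B) j ∘ₗ retr =
      proj ∘ₗ G.toLinearMap := by
    refine DirectSum.linearMap_ext R fun q => LinearMap.ext fun t => ?_
    simp only [LinearMap.comp_apply, retr, DirectSum.toModule_lof, LinearEquiv.coe_coe, hG]
    by_cases hq : q.1 + q.2 = j
    · subst hq
      rw [dif_pos rfl, wedgeSum_lof, hproj]
    · rw [dif_neg hq, LinearMap.zero_apply, map_zero, hproj' _ _ hq]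
  have h3 : (⋀[R]^j (A × B)).subtype ∘ₗ wedgeSum (LinearMap.inl R A B) (LinearMap.inr R A B) j =
      G.toLinearMap ∘ₗ incl := by
    refine DirectSum.linearMap_ext R fun q => LinearMap.ext fun t => ?_
    simp only [LinearMap.comp_apply, incl, DirectSum.toModule_lof, LinearEquiv.coe_coe, hG,
      wedgeSum_lof]
    obtain ⟨q, rfl⟩ := q
    rfl
  constructor
  · intro s t hst
    have h4 : G (incl s) = G (incl t) := by
      have hs := LinearMap.congr_fun h3 s
      rw [LinearMap.comp_apply, hst] at hs
      exact hs.symm.trans (LinearMap.congr_fun h3 t)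
    have h5 := congrArg retr (G.injective h4)
    rwa [← LinearMap.comp_apply, ← LinearMap.comp_apply, h1] at h5
  · intro z
    refine ⟨retr (G.symm z), ?_⟩
    have := LinearMap.congr_fun h2 (G.symm z)
    simpa [hproj] using this

theorem wedgeSum_bijective (f : A →ₗ[R] C) (g : B →ₗ[R] C)
    (h : Function.Bijective (f.coprod g)) (j : ℕ) : Function.Bijective (wedgeSum f g j) := by
  let e := LinearEquiv.ofBijective (f.coprod g) h
  have key : wedgeSum f g j = exteriorPower.map j (f.coprod g) ∘ₗ
      wedgeSum (LinearMap.inl R A B) (LinearMap.inr R A B) j := by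
    refine DirectSum.linearMap_ext R fun q => LinearMap.ext fun t => ?_
    rw [LinearMap.comp_apply, LinearMap.comp_apply, LinearMap.comp_apply, wedgeSum_lof,
      wedgeSum_lof, map_wedge, LinearMap.coprod_inl, LinearMap.coprod_inr]
  rw [key, LinearMap.coe_comp]
  refine Function.Bijective.comp ⟨?_, ?_⟩ (wedgeSum_inl_inr_bijective j)
  -- Exterior powers need not preserve injections; a left inverse is what makes this one injective.
  · exact exteriorPower.map_injective e.symm.toLinearMap
      (LinearMap.ext fun x => e.symm_apply_apply x)
  · exact exteriorPower.map_surjective h.2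

end Wedge

/-! ## The Künneth formula over a field -/

/-- Over a field, `V` maps onto the range of `f` with a linear section, and that section extends
from the range to all of `W`. -/
theorem exists_generalizedInverse {R : Type*} [CommRing R] (hR : IsField R) {V W : Type*}
    [AddCommGroup V] [Module R V] [AddCommGroup W] [Module R W] (f : V →ₗ[R] W) :
    ∃ g : W →ₗ[R] V, ∀ v, f (g (f v)) = f v := by
  let := hR.toField
  obtain ⟨s, hs⟩ := f.rangeRestrict.exists_rightInverse_of_surjective f.range_rangeRestrict
  obtain ⟨g, hg⟩ := LinearMap.exists_extend s
  refine ⟨g, fun v => ?_⟩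
  have h1 : g (f v) = s (f.rangeRestrict v) := LinearMap.congr_fun hg (f.rangeRestrict v)
  rw [h1]
  exact congrArg Subtype.val (LinearMap.congr_fun hs (f.rangeRestrict v))

namespace GradedComplex

variable {R : Type u} [CommRing R]

/-! ### Cohomology as a deformation retract -/

theorem d_d (A : GradedComplex.{u, v} R) {i j : ℕ} (x : A.X i j) :
    A.d (i + 1) j (A.d i j x) = 0 :=
  LinearMap.congr_fun (A.d_comp_d i j) x

theorem d_eq_zero_of_mem_coboundaries (A : GradedComplex.{u, v} R) :
    ∀ {i j : ℕ} {x : A.X i j}, x ∈ A.coboundaries i j → A.d i j x = 0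
  | 0, _, x, hx => by rw [(Submodule.mem_bot R).1 hx, map_zero]
  | i + 1, _, _, ⟨y, hy⟩ => by rw [← hy, A.d_d]

theorem cohomologyClass_eq_iff (A : GradedComplex.{u, v} R) {i j : ℕ} (x y : A.cocycles i j) :
    A.cohomologyClass x = A.cohomologyClass y ↔ x.1 - y.1 ∈ A.coboundaries i j :=
  Submodule.Quotient.eq _

/-- The cohomology of a graded complex, with zero differential. -/
def cohomologyComplex (A : GradedComplex.{u, v} R) : GradedComplex.{u, v} R where
  X := A.cohomology
  d _ _ := 0
  d_comp_d _ _ := LinearMap.comp_zero _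

/-- A deformation retraction of a graded complex onto its cohomology. -/
structure Retraction (A : GradedComplex.{u, v} R) where
  proj : ∀ i j, A.X i j →ₗ[R] A.cohomologyComplex.X i j
  sect : ∀ i j, A.cohomologyComplex.X i j →ₗ[R] A.X i j
  homotopy : ∀ i j, A.X (i + 1) j →ₗ[R] A.X i j
  proj_cocycle : ∀ i j (z : A.cocycles i j), proj i j z = A.cohomologyClass z
  d_sect : ∀ i j y, A.d i j (sect i j y) = 0
  proj_sect : ∀ i j y, proj i j (sect i j y) = y
  homotopy_zero : ∀ j x, homotopy 0 j (A.d 0 j x) = x - sect 0 j (proj 0 j x)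
  homotopy_succ : ∀ i j x, A.d i j (homotopy i j x) + homotopy (i + 1) j (A.d (i + 1) j x) =
    x - sect (i + 1) j (proj (i + 1) j x)

theorem Retraction.proj_d {A : GradedComplex.{u, v} R} (r : A.Retraction) (i j : ℕ) (x : A.X i j) :
    r.proj (i + 1) j (A.d i j x) = 0 := by
  have h1 := r.proj_cocycle (i + 1) j ⟨A.d i j x, A.d_d x⟩
  refine h1.trans ((A.cohomologyClass_eq_iff _ 0).2 ?_)
  rw [ZeroMemClass.coe_zero, sub_zero]
  exact ⟨x, rfl⟩

/-- Let `d g d = d`. Then `a = d g` projects onto the coboundaries and `b = 1 - g d` onto the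
cocycles, so `π = (1 - a) b` projects onto a complement of the coboundaries in the cocycles, which
is a copy of the cohomology. With the homotopy `h = (1 - a) g`, `d a = 0` gives `d h = a`, and `h d
= (1 - a)(1 - b)`; the sum is `1 - (1 - a) b = 1 - π`. -/
theorem nonempty_retraction (hR : IsField R) (A : GradedComplex.{u, v} R) :
    Nonempty A.Retraction := by
  choose g hg using fun i j => exists_generalizedInverse hR (A.d i j)
  -- In degree `0` the only coboundary is zero, so the projection onto the coboundaries is zero
  -- there.
  let a : ∀ i j, A.X i j →ₗ[R] A.X i j := fun i j => match i with
    | 0 => 0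
    | i + 1 => A.d i j ∘ₗ g i j
  have ha_mem : ∀ i j x, a i j x ∈ A.coboundaries i j := fun i j x => match i, x with
    | 0, _ => Submodule.zero_mem _
    | i + 1, x => ⟨g i j x, rfl⟩
  have ha_cob : ∀ i j x, x ∈ A.coboundaries i j → a i j x = x := fun i j x => match i, x with
    | 0, _ => fun hx => ((Submodule.mem_bot R).1 hx).symm
    | i + 1, x => by
      rintro ⟨y, rfl⟩
      exact hg i j y
  have hd_a : ∀ i j x, A.d i j (a i j x) = 0 := fun i j x =>
    A.d_eq_zero_of_mem_coboundaries (ha_mem i j x)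
  let b : ∀ i j, A.X i j →ₗ[R] A.X i j := fun i j => LinearMap.id - g i j ∘ₗ A.d i j
  let π : ∀ i j, A.X i j →ₗ[R] A.X i j := fun i j => (LinearMap.id - a i j) ∘ₗ b i j
  have hb : ∀ i j x, b i j x = x - g i j (A.d i j x) := fun _ _ _ => rfl
  have hπ : ∀ i j x, π i j x = b i j x - a i j (b i j x) := fun _ _ _ => rfl
  have hdπ : ∀ i j x, A.d i j (π i j x) = 0 := fun i j x => by
    rw [hπ, map_sub, hd_a, hb, map_sub, hg, sub_self, sub_zero]
  have hπz : ∀ i j x, A.d i j x = 0 → π i j x = x - a i j x := fun i j x hx => by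
    rw [hπ, hb, hx, map_zero, sub_zero]
  have hππ : ∀ i j x, π i j (π i j x) = π i j x := fun i j x => by
    rw [hπz _ _ _ (hdπ i j x), hπ, map_sub, ha_cob _ _ _ (ha_mem i j _), sub_self, sub_zero]
  let πZ : ∀ i j, A.X i j →ₗ[R] A.cocycles i j := fun i j =>
    (π i j).codRestrict (A.cocycles i j) (hdπ i j)
  let p : ∀ i j, A.X i j →ₗ[R] A.cohomology i j := fun i j => Submodule.mkQ _ ∘ₗ πZ i j
  let s : ∀ i j, A.cohomology i j →ₗ[R] A.X i j := fun i j =>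
    Submodule.liftQ _ (π i j ∘ₗ (A.cocycles i j).subtype) fun z hz => by
      have hz' : z.1 ∈ A.coboundaries i j := hz
      rw [LinearMap.mem_ker, LinearMap.comp_apply, Submodule.subtype_apply, hπz _ _ _ z.2,
        ha_cob _ _ _ hz', sub_self]
  have hp : ∀ i j (z : A.cocycles i j), p i j z = A.cohomologyClass z := fun i j z => by
    refine (A.cohomologyClass_eq_iff _ _).2 ?_
    have : π i j z.1 - z.1 = - a i j z.1 := by rw [hπz _ _ _ z.2]; abel
    exact this ▸ Submodule.neg_mem _ (ha_mem i j _)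
  -- Unfolded, `s (p x)` is `π (π x)`.
  have hsp : ∀ i j x, s i j (p i j x) = π i j x := hππ
  refine ⟨⟨p, s, fun i j => (LinearMap.id - a i j) ∘ₗ g i j, hp, ?_, ?_, ?_, ?_⟩⟩
  · intro i j y
    obtain ⟨z, rfl⟩ := Submodule.mkQ_surjective _ y
    exact hdπ i j z
  · intro i j y
    obtain ⟨z, rfl⟩ := Submodule.mkQ_surjective _ y
    -- The section sends the class of `z` to `π z`, whose class is by definition `p z`, hence the
    -- class of `z`.
    refine (hp i j (πZ i j z)).trans (hp i j z)
  · intro j x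
    refine Eq.trans ?_ (congrArg (x - ·) (hsp 0 j x)).symm
    rw [hπ, hb]
    simp [a]
  · intro i j x
    refine Eq.trans ?_ (congrArg (x - ·) (hsp (i + 1) j x)).symm
    rw [hπ, hb]
    have h1 : a (i + 1) j x = A.d i j (g i j x) := rfl
    simp only [LinearMap.comp_apply, LinearMap.sub_apply, LinearMap.id_apply, map_sub, hd_a, h1]
    abel

/-! ### Tensor products of retractions -/

theorem tensorX_ext {A : GradedComplex.{u, v} R} {B : GradedComplex.{u, w} R} {i j : ℕ}
    {Q : Type*} [AddCommMonoid Q] [Module R Q] {f g : TensorX A B i j →ₗ[R] Q}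
    (h : ∀ (a a' b b' : ℕ) (hi : a + a' = i) (hj : b + b' = j) (x : A.X a b) (y : B.X a' b'),
      f (tensorIncl A B hi hj (x ⊗ₜ y)) = g (tensorIncl A B hi hj (x ⊗ₜ y))) : f = g :=
  DirectSum.linearMap_ext R fun s => TensorProduct.ext' fun x y =>
    h s.1.1.1 s.1.1.2 s.2.1.1 s.2.1.2 s.1.2 s.2.2 x y

/-- The map on tensor products of graded complexes given by maps of bigraded modules. -/
def tensorMap {A A' : GradedComplex.{u, v} R} {B B' : GradedComplex.{u, w} R}
    (f : ∀ i j, A.X i j →ₗ[R] A'.X i j) (g : ∀ i j, B.X i j →ₗ[R] B'.X i j) (i j : ℕ) :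
    TensorX A B i j →ₗ[R] TensorX A' B' i j :=
  DirectSum.toModule R (Split i j) (TensorX A' B' i j) fun s =>
    tensorIncl A' B' s.1.2 s.2.2 ∘ₗ TensorProduct.map (f s.1.1.1 s.2.1.1) (g s.1.1.2 s.2.1.2)

theorem tensorMap_tensorIncl {A A' : GradedComplex.{u, v} R} {B B' : GradedComplex.{u, w} R}
    (f : ∀ i j, A.X i j →ₗ[R] A'.X i j) (g : ∀ i j, B.X i j →ₗ[R] B'.X i j) {i j a a' b b' : ℕ}
    (hi : a + a' = i) (hj : b + b' = j) (x : A.X a b) (y : B.X a' b') :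
    tensorMap f g i j (tensorIncl A B hi hj (x ⊗ₜ y)) =
      tensorIncl A' B' hi hj (f a b x ⊗ₜ g a' b' y) := by
  rw [tensorMap, tensorIncl, DirectSum.toModule_lof]
  rfl

/-- The map `h ⊗ 1` of degree `-1` on a summand of the tensor product. -/
def lowerLeft {A : GradedComplex.{u, v} R} (B : GradedComplex.{u, w} R)
    (h : ∀ i j, A.X (i + 1) j →ₗ[R] A.X i j) {i j b b' : ℕ} (hj : b + b' = j) :
    ∀ {a a' : ℕ}, a + a' = i + 1 → (A.X a b ⊗[R] B.X a' b' →ₗ[R] TensorX A B i j)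
  | 0, _, _ => 0
  | a + 1, _, hi => tensorIncl A B (by omega) hj ∘ₗ (h a b).rTensor _

/-- The map `± f ⊗ h` of degree `-1` on a summand of the tensor product. -/
def lowerRight {A : GradedComplex.{u, v} R} {B : GradedComplex.{u, w} R}
    (f : ∀ i j, A.X i j →ₗ[R] A.X i j) (h : ∀ i j, B.X (i + 1) j →ₗ[R] B.X i j)
    {i j b b' : ℕ} (hj : b + b' = j) :
    ∀ {a a' : ℕ}, a + a' = i + 1 → (A.X a b ⊗[R] B.X a' b' →ₗ[R] TensorX A B i j)
  | _, 0, _ => 0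
  | a, a' + 1, hi => (-1 : R) ^ a • (tensorIncl A B (by omega) hj ∘ₗ
      TensorProduct.map (f a b) (h a' b'))

namespace Retraction

variable {A : GradedComplex.{u, v} R} {B : GradedComplex.{u, w} R} (r : A.Retraction)
  (t : B.Retraction)

/-- The homotopy on a tensor product of complexes induced by retractions of the factors. -/
def tensorHomotopy (i j : ℕ) : TensorX A B (i + 1) j →ₗ[R] TensorX A B i j :=
  DirectSum.toModule R (Split (i + 1) j) (TensorX A B i j) fun s =>
    lowerLeft B r.homotopy s.2.2 s.1.2 +
      lowerRight (fun i j => r.sect i j ∘ₗ r.proj i j) t.homotopy s.2.2 s.1.2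

theorem tensorHomotopy_tensorIncl {i j a a' b b' : ℕ} (hi : a + a' = i + 1) (hj : b + b' = j)
    (x : A.X a b) (y : B.X a' b') :
    r.tensorHomotopy t i j (tensorIncl A B hi hj (x ⊗ₜ y)) =
      lowerLeft B r.homotopy hj hi (x ⊗ₜ y) +
        lowerRight (fun i j => r.sect i j ∘ₗ r.proj i j) t.homotopy hj hi (x ⊗ₜ y) := by
  rw [tensorHomotopy, tensorIncl, DirectSum.toModule_lof]
  rfl

theorem lowerLeft_zero_tmul (h : ∀ i j, A.X (i + 1) j →ₗ[R] A.X i j) {i j a' b b' : ℕ}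
    (hj : b + b' = j) (hi : 0 + a' = i + 1) (x : A.X 0 b) (y : B.X a' b') :
    lowerLeft B h hj hi (x ⊗ₜ y) = 0 := rfl

theorem lowerLeft_succ_tmul (h : ∀ i j, A.X (i + 1) j →ₗ[R] A.X i j) {i j a a' b b' : ℕ}
    (hj : b + b' = j) (hi : a + 1 + a' = i + 1) (x : A.X (a + 1) b) (y : B.X a' b') :
    lowerLeft B h hj hi (x ⊗ₜ y) = tensorIncl A B (by omega) hj (h a b x ⊗ₜ y) := rfl

theorem lowerRight_zero_tmul (f : ∀ i j, A.X i j →ₗ[R] A.X i j)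
    (h : ∀ i j, B.X (i + 1) j →ₗ[R] B.X i j) {i j a b b' : ℕ}
    (hj : b + b' = j) (hi : a + 0 = i + 1) (x : A.X a b) (y : B.X 0 b') :
    lowerRight f h hj hi (x ⊗ₜ y) = 0 := by
  cases a <;> rfl

theorem lowerRight_succ_tmul (f : ∀ i j, A.X i j →ₗ[R] A.X i j)
    (h : ∀ i j, B.X (i + 1) j →ₗ[R] B.X i j) {i j a a' b b' : ℕ}
    (hj : b + b' = j) (hi : a + (a' + 1) = i + 1) (x : A.X a b) (y : B.X (a' + 1) b') :
    lowerRight f h hj hi (x ⊗ₜ y) =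
      (-1 : R) ^ a • tensorIncl A B (by omega) hj (f a b x ⊗ₜ h a' b' y) := by
  cases a <;> rfl

/-- The projection of a tensor product of complexes onto the tensor product of the cohomologies. -/
abbrev tensorProj (i j : ℕ) : TensorX A B i j →ₗ[R]
    TensorX A.cohomologyComplex B.cohomologyComplex i j :=
  tensorMap (A' := A.cohomologyComplex) (B' := B.cohomologyComplex) r.proj t.proj i j

/-- The inclusion of the tensor product of the cohomologies into a tensor product of complexes. -/
abbrev tensorSect (i j : ℕ) : TensorX A.cohomologyComplex B.cohomologyComplex i j →ₗ[R]
    TensorX A B i j :=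
  tensorMap (A := A.cohomologyComplex) (B := B.cohomologyComplex) r.sect t.sect i j

theorem tensorProj_tensorSect (i j : ℕ) (x) :
    r.tensorProj t i j (r.tensorSect t i j x) = x := by
  have : r.tensorProj t i j ∘ₗ r.tensorSect t i j = LinearMap.id :=
    tensorX_ext fun _ _ _ _ _ _ x y => by
    simp only [LinearMap.comp_apply, tensorMap_tensorIncl, r.proj_sect, t.proj_sect,
      LinearMap.id_apply]
  exact LinearMap.congr_fun this x

theorem tensorD_tensorSect (i j : ℕ) (x) : tensorD A B i j (r.tensorSect t i j x) = 0 := by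
  have : tensorD A B i j ∘ₗ r.tensorSect t i j = 0 :=
    tensorX_ext fun _ _ _ _ _ _ x y => by
    simp only [LinearMap.comp_apply, tensorMap_tensorIncl, tensorD_tensorIncl, r.d_sect, t.d_sect,
      TensorProduct.zero_tmul, TensorProduct.tmul_zero, map_zero, smul_zero, add_zero,
      LinearMap.zero_apply]
  exact LinearMap.congr_fun this x

theorem tensorProj_tensorD (i j : ℕ) (x) : r.tensorProj t (i + 1) j (tensorD A B i j x) = 0 := by
  have : r.tensorProj t (i + 1) j ∘ₗ tensorD A B i j = 0 :=
    tensorX_ext fun _ _ _ _ _ _ x y => by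
    simp only [LinearMap.comp_apply, tensorD_tensorIncl, map_add, map_smul, tensorMap_tensorIncl,
      r.proj_d, t.proj_d, TensorProduct.zero_tmul, TensorProduct.tmul_zero, map_zero, smul_zero,
      add_zero, LinearMap.zero_apply]
  exact LinearMap.congr_fun this x

theorem sub_tensorSect_tensorProj_zero (j : ℕ) (x) :
    x - r.tensorSect t 0 j (r.tensorProj t 0 j x) = r.tensorHomotopy t 0 j (tensorD A B 0 j x) := by
  have : LinearMap.id - r.tensorSect t 0 j ∘ₗ r.tensorProj t 0 j =
      r.tensorHomotopy t 0 j ∘ₗ tensorD A B 0 j := tensorX_ext fun a a' b b' hi hj x y => by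
    obtain rfl : a = 0 := by omega
    obtain rfl : a' = 0 := by omega
    simp only [LinearMap.sub_apply, LinearMap.comp_apply, LinearMap.id_apply, tensorMap_tensorIncl,
      tensorD_tensorIncl, map_add, map_smul, tensorHomotopy_tensorIncl, lowerLeft_succ_tmul,
      lowerLeft_zero_tmul, lowerRight_succ_tmul, lowerRight_zero_tmul, r.homotopy_zero,
      t.homotopy_zero, TensorProduct.sub_tmul, TensorProduct.tmul_sub, map_sub]
    simp
  exact LinearMap.congr_fun this x

/-- Write `h`, `k` for the two homotopies and `π`, `π'` for the composites of projection and
section. In `H = h ⊗ 1 ± π ⊗ k` the terms `h x ⊗ d y` of `D H + H D` cancel by sign, and the terms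
with `d π` or `π d` vanish. What remains is `(1 - π) ⊗ 1 + π ⊗ (1 - π') = 1 - π ⊗ π'`. -/
theorem sub_tensorSect_tensorProj_succ (i j : ℕ) (x) :
    x - r.tensorSect t (i + 1) j (r.tensorProj t (i + 1) j x) =
      tensorD A B i j (r.tensorHomotopy t i j x) +
        r.tensorHomotopy t (i + 1) j (tensorD A B (i + 1) j x) := by
  -- Solving the homotopy identities for `h d` gives rewrite rules that leave only terms in `d h`,
  -- which then cancel.
  have hr : ∀ i j x, r.homotopy (i + 1) j (A.d (i + 1) j x) =
      x - r.sect (i + 1) j (r.proj (i + 1) j x) - A.d i j (r.homotopy i j x) := fun i j x => by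
    rw [← r.homotopy_succ, add_sub_cancel_left]
  have ht : ∀ i j x, t.homotopy (i + 1) j (B.d (i + 1) j x) =
      x - t.sect (i + 1) j (t.proj (i + 1) j x) - B.d i j (t.homotopy i j x) := fun i j x => by
    rw [← t.homotopy_succ, add_sub_cancel_left]
  have : LinearMap.id - r.tensorSect t (i + 1) j ∘ₗ r.tensorProj t (i + 1) j =
      tensorD A B i j ∘ₗ r.tensorHomotopy t i j +
        r.tensorHomotopy t (i + 1) j ∘ₗ tensorD A B (i + 1) j :=
    tensorX_ext fun a a' b b' hi hj x y => by
      have hneg : ∀ z : TensorX A B (i + 1) j, (-1 : R) • z = -z := fun z => neg_one_smul R z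
      rcases a with _ | a
      · rcases a' with _ | a'
        · omega
        simp only [LinearMap.sub_apply, LinearMap.add_apply, LinearMap.comp_apply,
          LinearMap.id_apply, tensorMap_tensorIncl, tensorD_tensorIncl, map_add,
          tensorHomotopy_tensorIncl, lowerLeft_succ_tmul, lowerLeft_zero_tmul,
          lowerRight_succ_tmul, r.homotopy_zero, ht, r.d_sect, r.proj_d,
          TensorProduct.sub_tmul, TensorProduct.tmul_sub, map_sub, map_zero, smul_zero,
          TensorProduct.zero_tmul, one_smul, pow_zero]
        abel
      -- Once `(-1)^a` is replaced by `1` or `-1`, the claim is an identity in an additive group.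
      · rcases neg_one_pow_eq_or R a with hε | hε <;> rcases a' with _ | a' <;>
        · simp only [LinearMap.sub_apply, LinearMap.add_apply, LinearMap.comp_apply,
            LinearMap.id_apply, tensorMap_tensorIncl, tensorD_tensorIncl, map_add, map_smul,
            tensorHomotopy_tensorIncl, lowerLeft_succ_tmul, lowerRight_succ_tmul,
            lowerRight_zero_tmul, t.homotopy_zero, hr, ht, r.d_sect, r.proj_d,
            TensorProduct.sub_tmul, TensorProduct.tmul_sub, map_sub, map_zero,
            smul_sub, smul_zero, TensorProduct.zero_tmul, pow_succ, hε, mul_neg_one, hneg,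
            one_smul, neg_neg]
          abel
  exact LinearMap.congr_fun this x

/-- On a cocycle with zero projection the homotopy identity reads `x = D (H x)`, or `x = 0` in
degree `0`. This is the injectivity half of the Künneth isomorphism. -/
theorem mem_coboundaries_of_tensorProj_eq_zero {i j : ℕ} {x : TensorX A B i j}
    (hx : tensorD A B i j x = 0) (hp : r.tensorProj t i j x = 0) :
    x ∈ (A.tensor B).coboundaries i j := by
  cases i with
  | zero =>
    have := r.sub_tensorSect_tensorProj_zero t j x
    rw [hx, hp, map_zero, map_zero, sub_zero] at this
    exact (Submodule.mem_bot R).2 this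
  | succ i =>
    have := r.sub_tensorSect_tensorProj_succ t i j x
    rw [hx, hp, map_zero, map_zero, sub_zero, add_zero] at this
    exact ⟨_, this.symm⟩

theorem tensorProj_eq_zero_of_mem_coboundaries {i j : ℕ} {x : TensorX A B i j}
    (hx : x ∈ (A.tensor B).coboundaries i j) : r.tensorProj t i j x = 0 := by
  cases i with
  | zero => rw [(Submodule.mem_bot R).1 hx, map_zero]
  | succ i =>
    obtain ⟨y, rfl⟩ := hx
    exact r.tensorProj_tensorD t i j y

/-- The isomorphism of the cohomology of a tensor product of complexes with the tensor product of
the cohomologies. -/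
def kunnethEquiv (i j : ℕ) : (A.tensor B).cohomology i j ≃ₗ[R]
    TensorX A.cohomologyComplex B.cohomologyComplex i j :=
  LinearEquiv.ofBijective
    (Submodule.liftQ _ (r.tensorProj t i j ∘ₗ ((A.tensor B).cocycles i j).subtype)
      fun _ hz => r.tensorProj_eq_zero_of_mem_coboundaries t hz) <| by
    constructor
    · refine (injective_iff_map_eq_zero _).2 fun z hz => ?_
      obtain ⟨z, rfl⟩ := Submodule.mkQ_surjective _ z
      exact (Submodule.Quotient.mk_eq_zero _).2
        (r.mem_coboundaries_of_tensorProj_eq_zero t z.2 hz)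
    · intro y
      exact ⟨(A.tensor B).cohomologyClass ⟨r.tensorSect t i j y, r.tensorD_tensorSect t i j y⟩,
        r.tensorProj_tensorSect t i j y⟩

theorem kunnethEquiv_cohomologyClass (i j : ℕ) (z : (A.tensor B).cocycles i j) :
    r.kunnethEquiv t i j ((A.tensor B).cohomologyClass z) = r.tensorProj t i j z.1 := rfl

end Retraction

theorem tensorIncl_mem_cocycles (A : GradedComplex.{u, v} R) (B : GradedComplex.{u, w} R)
    {i j a a' b b' : ℕ} (hi : a + a' = i) (hj : b + b' = j) (x : A.cocycles a b)
    (y : B.cocycles a' b') :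
    tensorIncl A B hi hj (x.1 ⊗ₜ y.1) ∈ (A.tensor B).cocycles i j := by
  refine (tensorD_tensorIncl A B hi hj x.1 y.1).trans ?_
  rw [LinearMap.mem_ker.1 x.2, LinearMap.mem_ker.1 y.2]
  simp

/-- The **Künneth formula** for graded complexes over a field. -/
theorem exists_kunnethEquiv (hR : IsField R) (A : GradedComplex.{u, v} R)
    (B : GradedComplex.{u, w} R) (i j : ℕ) :
    ∃ κ : TensorX A.cohomologyComplex B.cohomologyComplex i j ≃ₗ[R] (A.tensor B).cohomology i j,
      ∀ (a a' b b' : ℕ) (hi : a + a' = i) (hj : b + b' = j) (x : A.cocycles a b)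
        (y : B.cocycles a' b'),
        κ (tensorIncl A.cohomologyComplex B.cohomologyComplex hi hj
          (A.cohomologyClass x ⊗ₜ B.cohomologyClass y)) =
        (A.tensor B).cohomologyClass ⟨_, tensorIncl_mem_cocycles A B hi hj x y⟩ := by
  obtain ⟨r⟩ := nonempty_retraction hR A
  obtain ⟨t⟩ := nonempty_retraction hR B
  refine ⟨(r.kunnethEquiv t i j).symm, fun a a' b b' hi hj x y => ?_⟩
  -- The chosen retractions drop out here: each projection sends a cocycle to its class.
  rw [LinearEquiv.symm_apply_eq, Retraction.kunnethEquiv_cohomologyClass, tensorMap_tensorIncl,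
    r.proj_cocycle, t.proj_cocycle]

/-- The isomorphism on cohomology induced by an isomorphism of graded complexes. -/
theorem Iso.exists_cohomologyEquiv {A : GradedComplex.{u, v} R} {B : GradedComplex.{u, w} R}
    (Φ : Iso A B) (i j : ℕ) :
    ∃ (hz : ∀ x : A.cocycles i j, Φ.equiv i j x.1 ∈ B.cocycles i j)
      (ψ : A.cohomology i j ≃ₗ[R] B.cohomology i j),
      ∀ x, ψ (A.cohomologyClass x) = B.cohomologyClass ⟨_, hz x⟩ := by
  have hz : ∀ x : A.cocycles i j, Φ.equiv i j x.1 ∈ B.cocycles i j := fun x => by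
    refine LinearMap.mem_ker.2 ?_
    rw [← Φ.comm, LinearMap.mem_ker.1 x.2, map_zero]
  have hcob : ∀ x, Φ.equiv i j x ∈ B.coboundaries i j ↔ x ∈ A.coboundaries i j := fun x => by
    cases i with
    | zero =>
      exact (Submodule.mem_bot R (M := B.X 0 j)).trans
        ((Φ.equiv 0 j).map_eq_zero_iff.trans (Submodule.mem_bot R (M := A.X 0 j)).symm)
    | succ i =>
      constructor
      · rintro ⟨y, hy⟩
        refine ⟨(Φ.equiv i j).symm y, (Φ.equiv (i + 1) j).injective ?_⟩
        rw [Φ.comm, LinearEquiv.apply_symm_apply, hy]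
      · rintro ⟨y, rfl⟩
        exact ⟨Φ.equiv i j y, (Φ.comm i j y).symm⟩
  let f : A.cocycles i j →ₗ[R] B.cocycles i j :=
    ((Φ.equiv i j).toLinearMap ∘ₗ (A.cocycles i j).subtype).codRestrict _ hz
  let F : A.cohomology i j →ₗ[R] B.cohomology i j :=
    Submodule.liftQ _ (Submodule.mkQ _ ∘ₗ f) fun x hx => by
      refine (Submodule.Quotient.mk_eq_zero _).2 ?_
      exact (hcob x.1).2 hx
  refine ⟨hz, LinearEquiv.ofBijective F ⟨?_, ?_⟩, fun x => rfl⟩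
  · refine (injective_iff_map_eq_zero F).2 fun x hx => ?_
    obtain ⟨x, rfl⟩ := Submodule.mkQ_surjective _ x
    have : f x ∈ (B.coboundaries i j).submoduleOf (B.cocycles i j) :=
      (Submodule.Quotient.mk_eq_zero _).1 hx
    exact (Submodule.Quotient.mk_eq_zero _).2 ((hcob x.1).1 this)
  · intro y
    obtain ⟨y, rfl⟩ := Submodule.mkQ_surjective _ y
    refine ⟨A.cohomologyClass ⟨(Φ.equiv i j).symm y.1, ?_⟩, ?_⟩
    · refine LinearMap.mem_ker.2 ((Φ.equiv (i + 1) j).injective ?_)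
      rw [Φ.comm, LinearEquiv.apply_symm_apply, map_zero]
      exact y.2
    · exact congrArg (Submodule.mkQ _) (Subtype.ext ((Φ.equiv i j).apply_symm_apply y.1))

end GradedComplex

/-! ## Signs of shuffles -/

section Signs

variable (R : Type*) [CommRing R] {α : Type*} [LinearOrder α]

theorem sign_union {S S' : Finset α} (h : Disjoint S S') (e : α) :
    sign R (S ∪ S') e = sign R S e * sign R S' e := by
  rw [sign, sign, sign, Finset.filter_union,
    Finset.card_union_of_disjoint (Finset.disjoint_filter_filter h), pow_add]

theorem sign_mul_self (S : Finset α) (e : α) : sign R S e * sign R S e = 1 := by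
  rw [sign, ← mul_pow, neg_one_mul, neg_neg, one_pow]

/-- The sign of the permutation that sorts the concatenation of the finite sets `S` and `S'`. -/
def shuffleSign (S S' : Finset α) : R := ∏ s ∈ S, sign R S' s

theorem shuffleSign_mul_self (S S' : Finset α) : shuffleSign R S S' * shuffleSign R S S' = 1 := by
  rw [shuffleSign, ← Finset.prod_mul_distrib]
  exact Finset.prod_eq_one fun s _ => sign_mul_self R S' s

/-- Moving `e` into `S` multiplies the shuffle sign by `sign S' e`, which is exactly what `sign (S ∪
S') e` has beyond `sign S e`. -/
theorem sign_mul_shuffleSign_insert_left {S S' : Finset α} (h : Disjoint S S') {e : α}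
    (he : e ∉ S) :
    sign R S e * shuffleSign R (insert e S) S' = shuffleSign R S S' * sign R (S ∪ S') e := by
  rw [sign_union R h, shuffleSign, shuffleSign, Finset.prod_insert he]
  ring

/-- Distribute one factor `-1` to each `s`: since `s ≠ e`, negating the sign for `e < s` gives the
sign for `s < e`. -/
theorem prod_sign_singleton {S : Finset α} {e : α} (he : e ∉ S) :
    (-1) ^ S.card * ∏ s ∈ S, sign R {e} s = sign R S e := by
  induction S using Finset.induction_on with
  | empty => simp [sign]
  | insert a S ha ih =>
    rw [Finset.mem_insert, not_or] at he
    rw [Finset.card_insert_of_notMem ha, Finset.prod_insert ha, pow_succ, Finset.insert_eq,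
      sign_union R (Finset.disjoint_singleton_left.2 ha), ← ih he.2]
    have : -1 * sign R {e} a = sign R {a} e := by
      rcases lt_or_gt_of_ne he.1 with h | h <;> simp [sign, Finset.filter_singleton, h, h.not_gt]
    rw [← this]
    ring

/-- Moving `e` into `S'` multiplies the shuffle sign by `(-1)` to the number of elements of `S`
above `e`. The factor `(-1)^|S|` of the tensor differential turns this into the number below `e`,
which is the part of `sign (S ∪ S') e` due to `S`. -/
theorem sign_mul_shuffleSign_insert_right {S S' : Finset α} (h : Disjoint S S') {e : α}
    (he : e ∉ S) (he' : e ∉ S') :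
    (-1) ^ S.card * (sign R S' e * shuffleSign R S (insert e S')) =
      shuffleSign R S S' * sign R (S ∪ S') e := by
  have h1 : shuffleSign R S (insert e S') = (∏ s ∈ S, sign R {e} s) * shuffleSign R S S' := by
    rw [shuffleSign, shuffleSign, ← Finset.prod_mul_distrib, Finset.insert_eq]
    exact Finset.prod_congr rfl fun s _ => sign_union R (Finset.disjoint_singleton_left.2 he') s
  rw [h1, sign_union R h, ← prod_sign_singleton R he]
  ring

end Signs

/-! ## The complex of a direct sum -/

section QuotientProd

variable {R : Type*} [CommRing R] {N N' : Type*} [AddCommGroup N] [Module R N] [AddCommGroup N']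
  [Module R N']

/-- The submodule `P` is separate from `p.prod p'` because the direct sum quasi-representation takes
its value at `T` through the intersections of `T` with the two ground sets, which must first be
identified with the parts of `T`. -/
theorem coprod_mapQ_bijective (p : Submodule R N) (p' : Submodule R N')
    (P : Submodule R (N × N')) (hP : P = p.prod p') (h : p ≤ P.comap (LinearMap.inl R N N'))
    (h' : p' ≤ P.comap (LinearMap.inr R N N')) :
    Function.Bijective ((p.mapQ P _ h).coprod (p'.mapQ P _ h')) := by
  have key : ∀ x y, (p.mapQ P _ h).coprod (p'.mapQ P _ h')
      (Submodule.Quotient.mk x, Submodule.Quotient.mk y) = Submodule.Quotient.mk (x, y) :=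
    fun x y => by
      rw [LinearMap.coprod_apply, Submodule.mapQ_apply, Submodule.mapQ_apply,
        ← Submodule.Quotient.mk_add]
      simp
  constructor
  · refine (injective_iff_map_eq_zero _).2 ?_
    rintro ⟨x, y⟩ hxy
    obtain ⟨x, rfl⟩ := Submodule.mkQ_surjective _ x
    obtain ⟨y, rfl⟩ := Submodule.mkQ_surjective _ y
    rw [Submodule.mkQ_apply, Submodule.mkQ_apply, key, Submodule.Quotient.mk_eq_zero, hP] at hxy
    exact Prod.ext ((Submodule.Quotient.mk_eq_zero _).2 hxy.1)
      ((Submodule.Quotient.mk_eq_zero _).2 hxy.2)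
  · intro z
    obtain ⟨⟨x, y⟩, rfl⟩ := Submodule.mkQ_surjective _ z
    exact ⟨_, key x y⟩

end QuotientProd

section Sum

open GradedComplex

variable {R : Type*} [CommRing R] [IsDomain R] [IsPrincipalIdealRing R] {α : Type*}
  [LinearOrder α] {M M' : Matroid α} [M.Finite] [M'.Finite] (h : Disjoint M.E M'.E)
  {N N' : Type*} [AddCommGroup N] [Module R N] [Module.Finite R N]
  [AddCommGroup N'] [Module R N'] [Module.Finite R N'] (ρ : QuasiRep R M N) (ρ' : QuasiRep R M' N')

theorem disjoint_of_subset_ground (h : Disjoint M.E M'.E) {S S' : Finset α}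
    (hS : (S : Set α) ⊆ M.E) (hS' : (S' : Set α) ⊆ M'.E) : Disjoint S S' :=
  Finset.disjoint_coe.1 (Set.disjoint_of_subset hS hS' h)

/-- The union of subsets of the ground sets of two matroids. -/
def Subs.union {i a a' : ℕ} (hi : a + a' = i) (S : Subs M a) (S' : Subs M' a') :
    Subs (M.disjointSum M' h) i :=
  ⟨S.1 ∪ S'.1, by
    rw [Finset.coe_union, Matroid.disjointSum_ground_eq]
    exact Set.union_subset_union S.2.1 S'.2.1, by
    rw [Finset.card_union_of_disjoint (disjoint_of_subset_ground h S.2.1 S'.2.1), S.2.2, S'.2.2,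
      hi]⟩

theorem Subs.subset_union_left {i a a' : ℕ} (hi : a + a' = i) (S : Subs M a) (S' : Subs M' a') :
    S.1 ⊆ (S.union h hi S').1 := Finset.subset_union_left

theorem Subs.subset_union_right {i a a' : ℕ} (hi : a + a' = i) (S : Subs M a) (S' : Subs M' a') :
    S'.1 ⊆ (S.union h hi S').1 := Finset.subset_union_right

/-- A decomposition of a subset of the ground set of a direct sum of matroids into subsets of the
ground sets of the summands. -/
structure Decomp {h : Disjoint M.E M'.E} {i : ℕ} (T : Subs (M.disjointSum M' h) i) where
  leftCard : ℕ
  rightCard : ℕ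
  left : Subs M leftCard
  right : Subs M' rightCard
  union_eq : left.1 ∪ right.1 = T.1

namespace Decomp

variable {h} {i : ℕ} {T : Subs (M.disjointSum M' h) i} (D : Decomp T)

theorem card_add : D.leftCard + D.rightCard = i := by
  have h1 := T.2.2
  rwa [← D.union_eq,
    Finset.card_union_of_disjoint (disjoint_of_subset_ground h D.left.2.1 D.right.2.1),
    D.left.2.2, D.right.2.2] at h1

theorem inter_left : (T.1 : Set α) ∩ M.E = D.left.1 := by
  rw [← D.union_eq, Finset.coe_union, Set.union_inter_distrib_right,
    Set.inter_eq_self_of_subset_left D.left.2.1,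
    (h.symm.mono_left D.right.2.1).inter_eq, Set.union_empty]

theorem inter_right : (T.1 : Set α) ∩ M'.E = D.right.1 := by
  rw [← D.union_eq, Finset.coe_union, Set.union_inter_distrib_right,
    Set.inter_eq_self_of_subset_left D.right.2.1,
    (h.mono_left D.left.2.1).inter_eq, Set.empty_union]

instance : Subsingleton (Decomp T) := ⟨by
  intro D D'
  have h1 : D.left.1 = D'.left.1 := Finset.coe_injective (D.inter_left.symm.trans D'.inter_left)
  have h2 : D.right.1 = D'.right.1 :=
    Finset.coe_injective (D.inter_right.symm.trans D'.inter_right)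
  -- Replacing the cardinalities by those of the sets leaves the two sets as the only data to
  -- compare.
  obtain ⟨a, a', ⟨S, hS, rfl⟩, ⟨S', hS', rfl⟩, hD⟩ := D
  obtain ⟨b, b', ⟨U, hU, rfl⟩, ⟨U', hU', rfl⟩, hD'⟩ := D'
  obtain rfl : S = U := h1
  obtain rfl : S' = U' := h2
  rfl⟩

instance : Nonempty (Decomp T) := by
  classical
  refine ⟨⟨_, _, ⟨T.1.filter (· ∈ M.E), fun x hx => (Finset.mem_filter.1 hx).2, rfl⟩,
    ⟨T.1.filter (· ∈ M'.E), fun x hx => (Finset.mem_filter.1 hx).2, rfl⟩, ?_⟩⟩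
  have hT : (T.1 : Set α) ⊆ M.E ∪ M'.E := T.2.1.trans (Matroid.disjointSum_ground_eq ..).subset
  refine (Finset.filter_or _ _ _).symm.trans ?_
  exact Finset.filter_true_of_mem fun x hx => hT hx

end Decomp

theorem le_comap_inl {S T : Finset α} (hS : (S : Set α) ⊆ M.E) (hST : S ⊆ T) :
    ρ.ρ S ≤ ((ρ.directSum ρ' h).ρ T).comap (LinearMap.inl R N N') := fun _ hx =>
  ⟨ρ.mono S _ (Set.subset_inter (Finset.coe_subset.2 hST) hS) Set.inter_subset_right hx,
    Submodule.zero_mem _⟩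

theorem le_comap_inr {S T : Finset α} (hS : (S : Set α) ⊆ M'.E) (hST : S ⊆ T) :
    ρ'.ρ S ≤ ((ρ.directSum ρ' h).ρ T).comap (LinearMap.inr R N N') := fun _ hx =>
  ⟨Submodule.zero_mem _,
    ρ'.mono S _ (Set.subset_inter (Finset.coe_subset.2 hST) hS) Set.inter_subset_right hx⟩

/-- The map `N / ρ(S) → (N ⊕ N') / (ρ ⊕ ρ')(T)` for `S ⊆ T`. -/
abbrev quotInl {S T : Finset α} (hS : (S : Set α) ⊆ M.E) (hST : S ⊆ T) :
    (N ⧸ ρ.ρ (S : Set α)) →ₗ[R] (N × N') ⧸ (ρ.directSum ρ' h).ρ (T : Set α) :=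
  Submodule.mapQ _ _ _ (le_comap_inl h ρ ρ' hS hST)

/-- The map `N' / ρ'(S) → (N ⊕ N') / (ρ ⊕ ρ')(T)` for `S ⊆ T`. -/
abbrev quotInr {S T : Finset α} (hS : (S : Set α) ⊆ M'.E) (hST : S ⊆ T) :
    (N' ⧸ ρ'.ρ (S : Set α)) →ₗ[R] (N × N') ⧸ (ρ.directSum ρ' h).ρ (T : Set α) :=
  Submodule.mapQ _ _ _ (le_comap_inr h ρ ρ' hS hST)

/-- The product `⋀^b (N / ρ(S)) ⊗ ⋀^b' (N' / ρ'(S')) → ⋀^j ((N ⊕ N') / (ρ ⊕ ρ')(T))`. -/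
abbrev wedgeAt {S S' T : Finset α} (hS : (S : Set α) ⊆ M.E) (hST : S ⊆ T)
    (hS' : (S' : Set α) ⊆ M'.E) (hST' : S' ⊆ T) {b b' j : ℕ} (hj : b + b' = j) :
    chainAt ρ S b ⊗[R] chainAt ρ' S' b' →ₗ[R] chainAt (ρ.directSum ρ' h) T j :=
  wedge (quotInl h ρ ρ' hS hST) (quotInr h ρ ρ' hS' hST') hj

/-- Naturality of the wedge product. As `wedgeAt` allows any target containing both sets, applying a
differential only enlarges the target; likewise, in the next two lemmas, a differential on a factor
only shrinks the source set. -/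
theorem dAt_wedgeAt {S S' : Finset α} {i : ℕ} (T : Subs (M.disjointSum M' h) i)
    (hS : (S : Set α) ⊆ M.E) (hST : S ⊆ T.1) (hS' : (S' : Set α) ⊆ M'.E) (hST' : S' ⊆ T.1)
    {b b' j : ℕ} (hj : b + b' = j) (e : outside (M.disjointSum M' h) T.1)
    (t : chainAt ρ S b ⊗[R] chainAt ρ' S' b') :
    dAt (ρ.directSum ρ' h) T e j (wedgeAt h ρ ρ' hS hST hS' hST' hj t) =
      wedgeAt h ρ ρ' hS (hST.trans (Finset.subset_insert e.1 T.1)) hS'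
        (hST'.trans (Finset.subset_insert e.1 T.1)) hj t := by
  rw [dAt, wedgeAt, map_wedge]
  congr 1
  congr 1
  · ext; rfl
  · ext; rfl

theorem wedgeAt_dAt_left {S' T : Finset α} {a : ℕ} (S : Subs M a) (e : outside M S.1)
    (hST : (S.insert e).1 ⊆ T) (hS' : (S' : Set α) ⊆ M'.E) (hST' : S' ⊆ T)
    {b b' j : ℕ} (hj : b + b' = j) (x : chainAt ρ S.1 b) (y : chainAt ρ' S' b') :
    wedgeAt h ρ ρ' (S.insert e).2.1 hST hS' hST' hj (dAt ρ S e b x ⊗ₜ y) =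
      wedgeAt h ρ ρ' S.2.1 ((Finset.subset_insert e.1 S.1).trans hST) hS' hST' hj (x ⊗ₜ y) := by
  rw [dAt, wedgeAt, wedge_map_left]
  congr 2
  ext; rfl

theorem wedgeAt_dAt_right {S T : Finset α} {a : ℕ} (S' : Subs M' a) (e : outside M' S'.1)
    (hS : (S : Set α) ⊆ M.E) (hST : S ⊆ T) (hST' : (S'.insert e).1 ⊆ T)
    {b b' j : ℕ} (hj : b + b' = j) (x : chainAt ρ S b) (y : chainAt ρ' S'.1 b') :
    wedgeAt h ρ ρ' hS hST (S'.insert e).2.1 hST' hj (x ⊗ₜ dAt ρ' S' e b' y) =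
      wedgeAt h ρ ρ' hS hST S'.2.1 ((Finset.subset_insert e.1 S'.1).trans hST') hj (x ⊗ₜ y) := by
  rw [dAt, wedgeAt, wedge_map_right]
  congr 2
  ext; rfl

/-- This transports between sets that are equal without being so by definition, such as `insert e S
∪ S'` and `insert e (S ∪ S')`. -/
theorem chainIncl_wedgeAt_congr {i : ℕ} {S S' : Finset α} {T T' : Subs (M.disjointSum M' h) i}
    (hT : T = T') (hS : (S : Set α) ⊆ M.E) (hST : S ⊆ T.1) (hST₁ : S ⊆ T'.1)
    (hS' : (S' : Set α) ⊆ M'.E) (hST' : S' ⊆ T.1) (hST₁' : S' ⊆ T'.1) {b b' j : ℕ}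
    (hj : b + b' = j) (t : chainAt ρ S b ⊗[R] chainAt ρ' S' b') :
    chainIncl (ρ.directSum ρ' h) T j (wedgeAt h ρ ρ' hS hST hS' hST' hj t) =
      chainIncl (ρ.directSum ρ' h) T' j (wedgeAt h ρ ρ' hS hST₁ hS' hST₁' hj t) := by
  subst hT
  rfl

/-- The product of chain groups on `C^{S,b} ⊗ C^{S',b'}`, with the sign of the shuffle of `S`
and `S'`. -/
def unionMapAt {i j a a' b b' : ℕ} (hi : a + a' = i) (hj : b + b' = j) (S : Subs M a)
    (S' : Subs M' a') :
    chainAt ρ S.1 b ⊗[R] chainAt ρ' S'.1 b' →ₗ[R] chainGroup (ρ.directSum ρ' h) i j :=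
  shuffleSign R S.1 S'.1 • (chainIncl (ρ.directSum ρ' h) (S.union h hi S') j ∘ₗ
    wedgeAt h ρ ρ' S.2.1 (S.subset_union_left h hi S') S'.2.1
      (S.subset_union_right h hi S') (hj := hj))

/-- The product `C^{a,b}(M, ρ) ⊗ C^{a',b'}(M', ρ') → C^{a+a',b+b'}(M ⊕ M', ρ ⊕ ρ')`. -/
def unionMap {i j a a' b b' : ℕ} (hi : a + a' = i) (hj : b + b' = j) :
    chainGroup ρ a b ⊗[R] chainGroup ρ' a' b' →ₗ[R] chainGroup (ρ.directSum ρ' h) i j :=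
  TensorProduct.lift <| DirectSum.toModule R _ _ fun S => LinearMap.flip <|
    DirectSum.toModule R _ _ fun T => LinearMap.flip <|
      TensorProduct.curry (unionMapAt h ρ ρ' hi hj S T)

/-- The comparison map from the tensor product of the complexes of two matroids to the complex of
their direct sum. -/
def tensorToSum (i j : ℕ) :
    TensorX (charComplex ρ) (charComplex ρ') i j →ₗ[R] chainGroup (ρ.directSum ρ' h) i j :=
  DirectSum.toModule R (GradedComplex.Split i j) _ fun s => unionMap h ρ ρ' s.1.2 s.2.2

/-- A generator of the tensor product of the complexes of two matroids. -/
abbrev tensorGen {ρ : QuasiRep R M N} {ρ' : QuasiRep R M' N'} {i j a a' b b' : ℕ}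
    (hi : a + a' = i) (hj : b + b' = j) (S : Subs M a)
    (S' : Subs M' a') (x : chainAt ρ S.1 b) (y : chainAt ρ' S'.1 b') :
    TensorX (charComplex ρ) (charComplex ρ') i j :=
  tensorIncl (charComplex ρ) (charComplex ρ') hi hj (chainIncl ρ S b x ⊗ₜ chainIncl ρ' S' b' y)

theorem tensorToSum_tensorGen {i j a a' b b' : ℕ} (hi : a + a' = i) (hj : b + b' = j)
    (S : Subs M a) (S' : Subs M' a') (x : chainAt ρ S.1 b) (y : chainAt ρ' S'.1 b') :
    tensorToSum h ρ ρ' i j (tensorGen hi hj S S' x y) =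
      shuffleSign R S.1 S'.1 • chainIncl (ρ.directSum ρ' h) (S.union h hi S') j
        (wedgeAt h ρ ρ' S.2.1 (S.subset_union_left h hi S') S'.2.1 (S.subset_union_right h hi S') hj
          (x ⊗ₜ y)) := by
  have h1 : tensorToSum h ρ ρ' i j (tensorGen hi hj S S' x y) =
      unionMap h ρ ρ' hi hj (chainIncl ρ S b x ⊗ₜ chainIncl ρ' S' b' y) := by
    rw [tensorToSum, tensorGen, tensorIncl, DirectSum.toModule_lof]
  rw [h1, unionMap, TensorProduct.lift.tmul, DirectSum.toModule_lof, LinearMap.flip_apply,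
    DirectSum.toModule_lof]
  rfl

theorem tensorGen_ext {i j : ℕ} {Q : Type*} [AddCommMonoid Q] [Module R Q]
    {f g : TensorX (charComplex ρ) (charComplex ρ') i j →ₗ[R] Q}
    (hfg : ∀ (a a' b b' : ℕ) (hi : a + a' = i) (hj : b + b' = j) (S : Subs M a) (S' : Subs M' a')
      (x : chainAt ρ S.1 b) (y : chainAt ρ' S'.1 b'),
      f (tensorGen hi hj S S' x y) = g (tensorGen hi hj S S' x y)) : f = g := by
  refine DirectSum.linearMap_ext R fun s => TensorProduct.ext ?_
  refine DirectSum.linearMap_ext R fun S => LinearMap.ext fun x => ?_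
  refine DirectSum.linearMap_ext R fun S' => LinearMap.ext fun y => ?_
  exact hfg s.1.1.1 s.1.1.2 s.2.1.1 s.2.1.2 s.1.2 s.2.2 S S' x y

/-! ### Compatibility with the differentials -/

theorem sum_outside_union {i a a' : ℕ} (hi : a + a' = i) (S : Subs M a) (S' : Subs M' a')
    {Q : Type*} [AddCommMonoid Q]
    (F : outside (M.disjointSum M' h) (S.union h hi S').1 → Q)
    (hl : ∀ e : outside M S.1, e.1 ∈ outside (M.disjointSum M' h) (S.union h hi S').1)
    (hr : ∀ e : outside M' S'.1, e.1 ∈ outside (M.disjointSum M' h) (S.union h hi S').1) :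
    ∑ e, F e = ∑ e : outside M S.1, F ⟨e.1, hl e⟩ + ∑ e : outside M' S'.1, F ⟨e.1, hr e⟩ := by
  let φ : outside M S.1 ⊕ outside M' S'.1 → outside (M.disjointSum M' h) (S.union h hi S').1 :=
    Sum.elim (fun e => ⟨e.1, hl e⟩) (fun e => ⟨e.1, hr e⟩)
  have hφ : Function.Bijective φ := by
    constructor
    · refine Function.Injective.sumElim (fun e f hef => Subtype.ext (Subtype.mk.inj hef))
        (fun e f hef => Subtype.ext (Subtype.mk.inj hef)) fun e f hef => ?_
      have hef' : e.1 = f.1 := Subtype.mk.inj hef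
      exact Set.disjoint_left.1 h (mem_outside.1 e.2).1 (hef' ▸ (mem_outside.1 f.2).1)
    · intro e
      obtain ⟨h1, h2⟩ := mem_outside.1 e.2
      have h3 : e.1 ∉ S.1 ∪ S'.1 := h2
      rw [Finset.mem_union, not_or] at h3
      rcases (Matroid.disjointSum_ground_eq ..).subset h1 with h1 | h1
      · exact ⟨Sum.inl ⟨e.1, mem_outside.2 ⟨h1, h3.1⟩⟩, rfl⟩
      · exact ⟨Sum.inr ⟨e.1, mem_outside.2 ⟨h1, h3.2⟩⟩, rfl⟩
  rw [← hφ.sum_comp, Fintype.sum_sum_type]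
  rfl

theorem mem_outside_union_left {i a a' : ℕ} (hi : a + a' = i) (S : Subs M a) (S' : Subs M' a')
    (e : outside M S.1) : e.1 ∈ outside (M.disjointSum M' h) (S.union h hi S').1 := by
  obtain ⟨h1, h2⟩ := mem_outside.1 e.2
  refine mem_outside.2 ⟨(Matroid.disjointSum_ground_eq ..).superset (Or.inl h1), fun h3 => ?_⟩
  rcases Finset.mem_union.1 h3 with h3 | h3
  · exact h2 h3
  · exact Set.disjoint_left.1 h h1 (S'.2.1 h3)

theorem mem_outside_union_right {i a a' : ℕ} (hi : a + a' = i) (S : Subs M a) (S' : Subs M' a')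
    (e : outside M' S'.1) : e.1 ∈ outside (M.disjointSum M' h) (S.union h hi S').1 := by
  obtain ⟨h1, h2⟩ := mem_outside.1 e.2
  refine mem_outside.2 ⟨(Matroid.disjointSum_ground_eq ..).superset (Or.inr h1), fun h3 => ?_⟩
  rcases Finset.mem_union.1 h3 with h3 | h3
  · exact Set.disjoint_left.1 h (S.2.1 h3) h1
  · exact h2 h3

/-- Both sides are the same wedge product in the summand of `S ∪ S' ∪ {e}`, so the claim reduces to
the sign identity for moving `e` into `S`. -/
theorem tensorToSum_insert_left {i j a a' b b' : ℕ} (hi : a + a' = i)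
    (hi' : a + 1 + a' = i + 1) (hj : b + b' = j) (S : Subs M a) (S' : Subs M' a')
    (x : chainAt ρ S.1 b) (y : chainAt ρ' S'.1 b') (e : outside M S.1) :
    sign R S.1 e.1 • tensorToSum h ρ ρ' (i + 1) j
        (tensorGen hi' hj (S.insert e) S' (dAt ρ S e b x) y) =
      shuffleSign R S.1 S'.1 • sign R (S.union h hi S').1 e.1 •
        chainIncl (ρ.directSum ρ' h)
          ((S.union h hi S').insert ⟨e.1, mem_outside_union_left h hi S S' e⟩) j
          (dAt (ρ.directSum ρ' h) (S.union h hi S') _ j (wedgeAt h ρ ρ' S.2.1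
            (S.subset_union_left h hi S') S'.2.1 (S.subset_union_right h hi S') hj (x ⊗ₜ y))) := by
  rw [tensorToSum_tensorGen, wedgeAt_dAt_left, dAt_wedgeAt, smul_smul, smul_smul]
  refine congrArg₂ (· • ·) (sign_mul_shuffleSign_insert_left R
    (disjoint_of_subset_ground h S.2.1 S'.2.1) (mem_outside.1 e.2).2) ?_
  exact chainIncl_wedgeAt_congr h ρ ρ' (Subtype.ext (Finset.insert_union e.1 S.1 S'.1))
    _ _ _ _ _ _ _ _

theorem tensorToSum_insert_right {i j a a' b b' : ℕ} (hi : a + a' = i)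
    (hi' : a + (a' + 1) = i + 1) (hj : b + b' = j) (S : Subs M a) (S' : Subs M' a')
    (x : chainAt ρ S.1 b) (y : chainAt ρ' S'.1 b') (e : outside M' S'.1) :
    (-1 : R) ^ a • sign R S'.1 e.1 • tensorToSum h ρ ρ' (i + 1) j
        (tensorGen hi' hj S (S'.insert e) x (dAt ρ' S' e b' y)) =
      shuffleSign R S.1 S'.1 • sign R (S.union h hi S').1 e.1 •
        chainIncl (ρ.directSum ρ' h)
          ((S.union h hi S').insert ⟨e.1, mem_outside_union_right h hi S S' e⟩) j
          (dAt (ρ.directSum ρ' h) (S.union h hi S') _ j (wedgeAt h ρ ρ' S.2.1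
            (S.subset_union_left h hi S') S'.2.1 (S.subset_union_right h hi S') hj (x ⊗ₜ y))) := by
  have he := (mem_outside.1 (mem_outside_union_right h hi S S' e)).2
  have hs := sign_mul_shuffleSign_insert_right R (disjoint_of_subset_ground h S.2.1 S'.2.1)
    (fun h1 => he (Finset.mem_union_left _ h1)) (mem_outside.1 e.2).2
  rw [S.2.2] at hs
  rw [tensorToSum_tensorGen, wedgeAt_dAt_right, dAt_wedgeAt, smul_smul, smul_smul, smul_smul]
  refine congrArg₂ (· • ·) ((mul_assoc _ _ _).trans hs) ?_
  exact chainIncl_wedgeAt_congr h ρ ρ' (Subtype.ext (Finset.union_insert e.1 S.1 S'.1))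
    _ _ _ _ _ _ _ _

theorem tensorD_tensorGen {i j a a' b b' : ℕ} (hi : a + a' = i) (hj : b + b' = j) (S : Subs M a)
    (S' : Subs M' a') (x : chainAt ρ S.1 b) (y : chainAt ρ' S'.1 b') :
    tensorD (charComplex ρ) (charComplex ρ') i j (tensorGen hi hj S S' x y) =
      ∑ e : outside M S.1, sign R S.1 e.1 •
        tensorGen (show a + 1 + a' = i + 1 by omega) hj (S.insert e) S' (dAt ρ S e b x) y +
      (-1 : R) ^ a • ∑ e : outside M' S'.1, sign R S'.1 e.1 •
        tensorGen (show a + (a' + 1) = i + 1 by omega) hj S (S'.insert e) x (dAt ρ' S' e b' y) := by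
  refine (tensorD_tensorIncl _ _ hi hj _ _).trans ?_
  refine congrArg₂ (fun u v => tensorIncl (charComplex ρ) (charComplex ρ') _ hj (u ⊗ₜ _) +
    (-1 : R) ^ a • tensorIncl (charComplex ρ) (charComplex ρ') _ hj (_ ⊗ₜ v))
    (chainD_chainIncl ρ S b x) (chainD_chainIncl ρ' S' b' y) |>.trans ?_
  simp only [TensorProduct.sum_tmul, TensorProduct.tmul_sum, ← TensorProduct.smul_tmul',
    TensorProduct.tmul_smul, map_sum, map_smul]

/-- The complement of `S ∪ S'` is the disjoint union of the complements of `S` and `S'`. Its two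
parts match the two terms of the tensor differential, element by element. -/
theorem tensorToSum_tensorD (i j : ℕ) (z : TensorX (charComplex ρ) (charComplex ρ') i j) :
    tensorToSum h ρ ρ' (i + 1) j (tensorD (charComplex ρ) (charComplex ρ') i j z) =
      chainD (ρ.directSum ρ' h) i j (tensorToSum h ρ ρ' i j z) := by
  have : tensorToSum h ρ ρ' (i + 1) j ∘ₗ tensorD (charComplex ρ) (charComplex ρ') i j =
      chainD (ρ.directSum ρ' h) i j ∘ₗ tensorToSum h ρ ρ' i j := by
    refine tensorGen_ext ρ ρ' fun a a' b b' hi hj S S' x y => ?_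
    rw [LinearMap.comp_apply, LinearMap.comp_apply, tensorToSum_tensorGen, map_smul,
      chainD_chainIncl, tensorD_tensorGen]
    rw [sum_outside_union h hi S S' _ (mem_outside_union_left h hi S S')
      (mem_outside_union_right h hi S S'), map_add, map_smul, map_sum, map_sum, smul_add,
      Finset.smul_sum, Finset.smul_sum, Finset.smul_sum]
    simp only [map_smul]
    exact congrArg₂ (· + ·)
      (Finset.sum_congr rfl fun e _ => tensorToSum_insert_left h ρ ρ' hi _ hj S S' x y e)
      (Finset.sum_congr rfl fun e _ => tensorToSum_insert_right h ρ ρ' hi _ hj S S' x y e)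
  exact LinearMap.congr_fun this z

/-! ### Invertibility of the comparison map -/

theorem Decomp.left_subset {h : Disjoint M.E M'.E} {i : ℕ} {T : Subs (M.disjointSum M' h) i}
    (D : Decomp T) : D.left.1 ⊆ T.1 := by
  rw [← D.union_eq]
  exact Finset.subset_union_left

theorem Decomp.right_subset {h : Disjoint M.E M'.E} {i : ℕ} {T : Subs (M.disjointSum M' h) i}
    (D : Decomp T) : D.right.1 ⊆ T.1 := by
  rw [← D.union_eq]
  exact Finset.subset_union_right

theorem Decomp.directSum_eq {h : Disjoint M.E M'.E} {i : ℕ} {T : Subs (M.disjointSum M' h) i}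
    (D : Decomp T) : (ρ.directSum ρ' h).ρ T.1 = (ρ.ρ D.left.1).prod (ρ'.ρ D.right.1) := by
  rw [← D.inter_left, ← D.inter_right]
  rfl

theorem Decomp.coprod_quot_bijective {h : Disjoint M.E M'.E} {i : ℕ}
    {T : Subs (M.disjointSum M' h) i} (D : Decomp T) :
    Function.Bijective ((quotInl h ρ ρ' D.left.2.1 D.left_subset).coprod
      (quotInr h ρ ρ' D.right.2.1 D.right_subset)) :=
  coprod_mapQ_bijective _ _ _ (D.directSum_eq (ρ' := ρ') (ρ := ρ)) _ _

/-- The chain group of the direct sum at `T` is the sum of the tensor products of the chain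
groups of the summands. -/
def Decomp.chainEquiv {h : Disjoint M.E M'.E} {i : ℕ} {T : Subs (M.disjointSum M' h) i}
    (D : Decomp T) (j : ℕ) :
    (⨁ q : SumPair j, BiPower R (N ⧸ ρ.ρ (D.left.1 : Set α)) (N' ⧸ ρ'.ρ (D.right.1 : Set α)) q.1)
      ≃ₗ[R] chainAt (ρ.directSum ρ' h) T.1 j :=
  LinearEquiv.ofBijective
    (wedgeSum (quotInl h ρ ρ' D.left.2.1 D.left_subset)
      (quotInr h ρ ρ' D.right.2.1 D.right_subset) j)
    (wedgeSum_bijective _ _ (D.coprod_quot_bijective (ρ' := ρ') (ρ := ρ)) j)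

/-- The inclusion of the part of the tensor product of the complexes of two matroids indexed by
the two parts of a decomposition. -/
def Decomp.toTensor {h : Disjoint M.E M'.E} {i : ℕ} {T : Subs (M.disjointSum M' h) i}
    (D : Decomp T) (j : ℕ) :
    (⨁ q : SumPair j, BiPower R (N ⧸ ρ.ρ (D.left.1 : Set α)) (N' ⧸ ρ'.ρ (D.right.1 : Set α)) q.1)
      →ₗ[R] TensorX (charComplex ρ) (charComplex ρ') i j :=
  DirectSum.toModule R (SumPair j) _ fun q =>
    tensorIncl (charComplex ρ) (charComplex ρ') D.card_add q.2 ∘ₗ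
      TensorProduct.map (chainIncl ρ D.left q.1.1) (chainIncl ρ' D.right q.1.2)

theorem Decomp.toTensor_lof {h : Disjoint M.E M'.E} {i : ℕ} {T : Subs (M.disjointSum M' h) i}
    (D : Decomp T) (j : ℕ) (q : SumPair j) (x : chainAt ρ D.left.1 q.1.1)
    (y : chainAt ρ' D.right.1 q.1.2) :
    D.toTensor ρ ρ' j (DirectSum.lof R (SumPair j) (fun q => BiPower R
      (N ⧸ ρ.ρ (D.left.1 : Set α)) (N' ⧸ ρ'.ρ (D.right.1 : Set α)) q.1) q (x ⊗ₜ y)) =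
      tensorGen D.card_add q.2 D.left D.right x y := by
  rw [Decomp.toTensor, DirectSum.toModule_lof]
  rfl

/-- On the block of the tensor product belonging to `T`, the comparison map is the isomorphism of
exterior powers up to a sign. This is what makes it invertible block by block. -/
theorem tensorToSum_toTensor {i : ℕ} {T : Subs (M.disjointSum M' h) i} (D : Decomp T) (j : ℕ) (t) :
    tensorToSum h ρ ρ' i j (D.toTensor ρ ρ' j t) =
      shuffleSign R D.left.1 D.right.1 •
        chainIncl (ρ.directSum ρ' h) T j (D.chainEquiv ρ ρ' j t) := by
  have : tensorToSum h ρ ρ' i j ∘ₗ D.toTensor ρ ρ' j = shuffleSign R D.left.1 D.right.1 •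
      (chainIncl (ρ.directSum ρ' h) T j ∘ₗ (D.chainEquiv ρ ρ' j).toLinearMap) := by
    refine DirectSum.linearMap_ext R fun q => TensorProduct.ext' fun x y => ?_
    have h1 : D.chainEquiv ρ ρ' j (DirectSum.lof R (SumPair j) (fun q => BiPower R
        (N ⧸ ρ.ρ (D.left.1 : Set α)) (N' ⧸ ρ'.ρ (D.right.1 : Set α)) q.1) q (x ⊗ₜ y)) =
        wedgeAt h ρ ρ' D.left.2.1 D.left_subset D.right.2.1
          D.right_subset q.2 (x ⊗ₜ y) := wedgeSum_lof _ _ j q (x ⊗ₜ y)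
    have h2 : D.left.union h D.card_add D.right = T := Subtype.ext D.union_eq
    simp only [LinearMap.comp_apply, LinearMap.smul_apply, LinearEquiv.coe_coe]
    rw [D.toTensor_lof ρ ρ', h1, tensorToSum_tensorGen]
    exact congrArg _ (chainIncl_wedgeAt_congr h ρ ρ' h2 _ _ _ _ _ _ _ _)
  exact LinearMap.congr_fun this t

/-- The inverse of the comparison map on the chain group at `T`. -/
def Decomp.sumToTensor {h : Disjoint M.E M'.E} {i : ℕ} {T : Subs (M.disjointSum M' h) i}
    (D : Decomp T) (j : ℕ) :
    chainAt (ρ.directSum ρ' h) T.1 j →ₗ[R] TensorX (charComplex ρ) (charComplex ρ') i j :=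
  -- The shuffle sign squares to `1`, so the inverse carries the same sign.
  LinearMap.lsmul R (TensorX (charComplex ρ) (charComplex ρ') i j)
      (shuffleSign R D.left.1 D.right.1) ∘ₗ
    D.toTensor ρ ρ' j ∘ₗ (D.chainEquiv ρ ρ' j).symm.toLinearMap

/-- The inverse of the comparison map. -/
def sumToTensor (i j : ℕ) :
    chainGroup (ρ.directSum ρ' h) i j →ₗ[R] TensorX (charComplex ρ) (charComplex ρ') i j :=
  DirectSum.toModule R _ _ fun T => (Classical.arbitrary (Decomp T)).sumToTensor ρ ρ' j

/-- Decompositions are unique, so the arbitrary one in the definition may be replaced by any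
convenient one. -/
theorem sumToTensor_chainIncl {i : ℕ} {T : Subs (M.disjointSum M' h) i} (D : Decomp T) (j : ℕ)
    (z : chainAt (ρ.directSum ρ' h) T.1 j) :
    sumToTensor h ρ ρ' i j (chainIncl (ρ.directSum ρ' h) T j z) =
      shuffleSign R D.left.1 D.right.1 •
        D.toTensor ρ ρ' j ((D.chainEquiv ρ ρ' j).symm z) := by
  rw [sumToTensor, DirectSum.toModule_lof, Subsingleton.elim (Classical.arbitrary (Decomp T)) D]
  rfl

theorem tensorToSum_comp_sumToTensor (i j : ℕ) :
    tensorToSum h ρ ρ' i j ∘ₗ sumToTensor h ρ ρ' i j = LinearMap.id := by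
  refine DirectSum.linearMap_ext R fun T => LinearMap.ext fun z => ?_
  have D := Classical.arbitrary (Decomp T)
  rw [LinearMap.comp_apply, LinearMap.comp_apply, sumToTensor_chainIncl h ρ ρ' D, map_smul,
    tensorToSum_toTensor, LinearEquiv.apply_symm_apply, smul_smul, shuffleSign_mul_self, one_smul]
  rfl

theorem sumToTensor_comp_tensorToSum (i j : ℕ) :
    sumToTensor h ρ ρ' i j ∘ₗ tensorToSum h ρ ρ' i j = LinearMap.id := by
  refine tensorGen_ext ρ ρ' fun a a' b b' hi hj S S' x y => ?_
  -- With this decomposition the generator lies in the image of `toTensor` with no change of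
  -- indices.
  let D : Decomp (S.union h hi S') := ⟨a, a', S, S', rfl⟩
  have h1 := D.toTensor_lof ρ ρ' j ⟨(b, b'), hj⟩ x y
  rw [LinearMap.comp_apply, LinearMap.id_apply]
  refine (congrArg (fun t => sumToTensor h ρ ρ' i j (tensorToSum h ρ ρ' i j t)) h1.symm).trans
    (Eq.trans ?_ h1)
  rw [tensorToSum_toTensor, map_smul, sumToTensor_chainIncl h ρ ρ' D, LinearEquiv.symm_apply_apply,
    smul_smul, shuffleSign_mul_self, one_smul]

/-- The complex of a direct sum is the tensor product of the complexes of the summands. -/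
def directSumIso : Iso ((charComplex ρ).tensor (charComplex ρ'))
    (charComplex (ρ.directSum ρ' h)) where
  equiv i j := LinearEquiv.ofLinearMap (tensorToSum h ρ ρ' i j) (sumToTensor h ρ ρ' i j)
    (tensorToSum_comp_sumToTensor h ρ ρ' i j) (sumToTensor_comp_tensorToSum h ρ ρ' i j)
  comm := tensorToSum_tensorD h ρ ρ'

end Sum

end MatroidCohomology

end

open MatroidCohomology GradedComplex in
theorem proposition4p7 {R : Type*} [CommRing R] [IsDomain R] [IsPrincipalIdealRing R]
    {α : Type*} [LinearOrder α] (M M' : Matroid α) [M.Finite] [M'.Finite]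
    (h : Disjoint M.E M'.E) {N N' : Type*}
    [AddCommGroup N] [Module R N] [Module.Finite R N]
    [AddCommGroup N'] [Module R N'] [Module.Finite R N']
    (ρ : QuasiRep R M N) (ρ' : QuasiRep R M' N') :
    ∃ Φ : Iso ((charComplex ρ).tensor (charComplex ρ')) (charComplex (ρ.directSum ρ' h)),
      IsField R → ∀ i j : ℕ,
        ∃ κ : (⨁ s : Split i j, (charComplex ρ).cohomology s.1.1.1 s.2.1.1 ⊗[R]
              (charComplex ρ').cohomology s.1.1.2 s.2.1.2) ≃ₗ[R]
            (charComplex (ρ.directSum ρ' h)).cohomology i j,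
          ∀ (s : Split i j) (x : (charComplex ρ).cocycles s.1.1.1 s.2.1.1)
            (y : (charComplex ρ').cocycles s.1.1.2 s.2.1.2),
            ∃ hz : Φ.equiv i j (tensorIncl (charComplex ρ) (charComplex ρ') s.1.2 s.2.2
                (x.1 ⊗ₜ[R] y.1)) ∈ (charComplex (ρ.directSum ρ' h)).cocycles i j,
              κ (DirectSum.lof R (Split i j)
                  (fun s => (charComplex ρ).cohomology s.1.1.1 s.2.1.1 ⊗[R]
                    (charComplex ρ').cohomology s.1.1.2 s.2.1.2) s
                  ((charComplex ρ).cohomologyClass x ⊗ₜ[R]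
                    (charComplex ρ').cohomologyClass y)) =
                (charComplex (ρ.directSum ρ' h)).cohomologyClass ⟨_, hz⟩ := by
  refine ⟨directSumIso h ρ ρ', fun hR i j => ?_⟩
  -- The chain groups of `cohomologyComplex` are the cohomology modules, so the domain of this `κ`
  -- is by definition the direct sum in the claim.
  obtain ⟨κ, hκ⟩ := exists_kunnethEquiv hR (charComplex ρ) (charComplex ρ') i j
  obtain ⟨hz, ψ, hψ⟩ := (directSumIso h ρ ρ').exists_cohomologyEquiv i j
  -- The composite sends `[x] ⊗ [y]` to `[x ⊗ y]` and then to `[Φ (x ⊗ y)]`.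
  refine ⟨κ.trans ψ, fun s x y => ?_⟩
  let z : ((charComplex ρ).tensor (charComplex ρ')).cocycles i j :=
    ⟨_, tensorIncl_mem_cocycles (charComplex ρ) (charComplex ρ') s.1.2 s.2.2 x y⟩
  exact ⟨hz z, (congrArg ψ (hκ s.1.1.1 s.1.1.2 s.2.1.1 s.2.1.2 s.1.2 s.2.2 x y)).trans (hψ z)⟩
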